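/- Let $0\le N\le L$ be integers. Let $S_1,\dots,S_{L-N}$ be mutually independent discrete memoryless sources with finite alphabets $\mathcal S_1,\dots,\mathcal S_{L-N}$, and let $S_k^n$ denote $n$ i.i.d. samples of $S_k$. A code of block length $n$ for the $(L,N)$ secure symmetrical multilevel diversity coding (S-SMDC) problem consists of a random key $K$ that is independent of the sources (with no restriction on the key space), encoding functions $e_l:\prod_{k}\mathcal S_k^n\times\mathcal K\to\{1,\dots,M_l\}$ for $l=1,\dots,L$, with outputs $X_l=e_l(S_1^n,\dots,S_{L-N}^n,K)$, and decoding functions $d_U:\prod_{l\in U}\{1,\dots,M_l\}\to\prod_{k=1}^{|U|-N}\mathcal S_k^n$ for all $U\subseteq\{1,\dots,L\}$ with $|U|\ge N+1$. Write $X_U=(X_l)_{l\in U}$. A nonnegative rate tuple $(R_1,\dots,R_L)$ is admissible if for every $\epsilon>0$ and all sufficiently large $n$ there is such a code with 1. $\frac1n\log M_l\le R_l+\epsilon$ for all $l$; 2. $\Pr\{d_U(X_U)\ne(S_1^n,\dots,S_{|U|-N}^n)\}\le\epsilon$ for all $U$ with $|U|\ge N+1$; 3. $H(S_1^n,\dots,S_{L-N}^n\mid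 X_A)=H(S_1^n,\dots,S_{L-N}^n)$ for all $A\subseteq\{1,\dots,L\}$ with $|A|\le N$. An $(L,N,m)$ secure symmetrical single-level (S-SSDC) code is the analogue for one source, which has to be recovered with error probability at most $\epsilon$ from any $X_U$ with $|U|\ge m$, and kept perfectly secret from any $X_A$ with $|A|\le N$. A superposition code encodes each source $S_k$ separately, with its own independent key, by an $(L,N,N+k)$ S-SSDC code with outputs $X_l^{(k)}$ and rates $R_l^{(k)}$, and uses the encoder outputs $X_l=(X_l^{(1)},\dots,X_l^{(L-N)})$, of rates $R_l=\sum_{k}R_l^{(k)}$. Then the minimum of $\sum_{l=1}^L R_l$ over all admissible rate tuples of the $(L,N)$ S-SMDC problem is attained and equals $$R_{ms}=\sum_{k=1}^{L-N}\frac{L}{k}\,H(S_k),$$ and superposition coding achieves it: some rate tuple with this sum is achieved by superposition codes. -/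

import Mathlib

open MeasureTheory ProbabilityTheory

noncomputable section

namespace SecureDiversity

universe u

/-! ### Shannon entropy of finitely valued random variables (in nats) -/

/-- `H(X)`. -/
def entropy {Ω α : Type*} [MeasurableSpace Ω] [Fintype α] (μ : Measure Ω) (X : Ω → α) : ℝ :=
  ∑ x, Real.negMulLog (μ.real (X ⁻¹' {x}))

/-- `H(X | Y) = ∑ y, P(Y = y) H(X | Y = y)`. -/
def condEntropy {Ω α β : Type*} [MeasurableSpace Ω] [Fintype α] [Fintype β]
    (μ : Measure Ω) (X : Ω → α) (Y : Ω → β) : ℝ :=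
  ∑ y, μ.real (Y ⁻¹' {y}) * entropy (ProbabilityTheory.cond μ (Y ⁻¹' {y})) X

/-! ### Secure symmetrical single-level diversity coding -/

/-- A code of block length `n` with output alphabets of sizes `M l` for the `(L, N, m)` secure
single-level problem (the secrecy threshold `N` does not enter into the shape of a code). The key
is an arbitrary random element of an arbitrary probability space. As the encoder
outputs are finite, key spaces in higher universes would give nothing new. -/
structure SingleCode (L m : ℕ) (S : Type u) (n : ℕ) (M : Fin L → ℕ) where
  /-- the key space -/
  Key : Type
  /-- its measurable sets -/
  instMeas : MeasurableSpace Key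
  /-- the distribution of the key -/
  keyLaw : Measure Key
  instProb : IsProbabilityMeasure keyLaw
  /-- the encoding functions -/
  enc : (l : Fin L) → (Fin n → S) → Key → Fin (M l)
  measurable_enc : ∀ l s, Measurable (enc l s)
  /-- the decoding functions -/
  dec : (U : Finset (Fin L)) → m ≤ U.card → ((l : U) → Fin (M l)) → (Fin n → S)

attribute [instance] SingleCode.instMeas SingleCode.instProb

namespace SingleCode

variable {L m : ℕ} {S : Type u} {n : ℕ} {M : Fin L → ℕ}

/-- The joint law of `(S^n, K)`: the source is i.i.d. with law `P`, the key is independent of it. -/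
def law [MeasurableSpace S] (c : SingleCode L m S n M) (P : Measure S) :
    Measure ((Fin n → S) × c.Key) :=
  (Measure.pi fun _ : Fin n => P).prod c.keyLaw

/-- The encoder outputs `X_U = (X_l)_{l ∈ U}` as a random variable. -/
def output (c : SingleCode L m S n M) (U : Finset (Fin L)) (ω : (Fin n → S) × c.Key) :
    (l : U) → Fin (M l) :=
  fun l => c.enc l ω.1 ω.2

/-- Rate constraints, reconstruction up to error probability `ε`, and perfect secrecy against
any `N` encoder outputs. -/
structure Meets [Fintype S] [MeasurableSpace S] (c : SingleCode L m S n M) (P : Measure S)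
    (N : ℕ) (R : Fin L → ℝ) (ε : ℝ) : Prop where
  rate : ∀ l, 1 / (n : ℝ) * Real.log (M l) ≤ R l + ε
  reconstruct : ∀ (U : Finset (Fin L)) (hU : m ≤ U.card),
    (c.law P).real {ω | c.dec U hU (c.output U ω) ≠ ω.1} ≤ ε
  secret : ∀ A : Finset (Fin L), A.card ≤ N →
    condEntropy (c.law P) Prod.fst (c.output A) = entropy (c.law P) Prod.fst

end SingleCode

/-! ### Secure symmetrical multilevel diversity coding

The sources `S_1, …, S_{L-N}` are indexed by `k : Fin (L - N)`, so `k` stands for the source with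
number `k + 1`. -/

/-- A code of block length `n` with output alphabets of sizes `M l` for the `(L, N)` secure
multilevel problem. From the outputs in `U`, the decoder outputs estimates of the first
`|U| - N` sources. -/
structure MultiCode (L N : ℕ) (S : Fin (L - N) → Type u) (n : ℕ) (M : Fin L → ℕ) where
  /-- the key space -/
  Key : Type
  /-- its measurable sets -/
  instMeas : MeasurableSpace Key
  /-- the distribution of the key -/
  keyLaw : Measure Key
  instProb : IsProbabilityMeasure keyLaw
  /-- the encoding functions -/
  enc : (l : Fin L) → ((k : Fin (L - N)) → Fin n → S k) → Key → Fin (M l)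
  measurable_enc : ∀ l s, Measurable (enc l s)
  /-- the decoding functions -/
  dec : (U : Finset (Fin L)) → N + 1 ≤ U.card → ((l : U) → Fin (M l)) →
    (k : {k : Fin (L - N) // N + (k + 1) ≤ U.card}) → Fin n → S k

attribute [instance] MultiCode.instMeas MultiCode.instProb

namespace MultiCode

variable {L N : ℕ} {S : Fin (L - N) → Type u} {n : ℕ} {M : Fin L → ℕ}

/-- The joint law of `((S_1^n, …, S_{L-N}^n), K)`: the sources are i.i.d. in time with laws `P k`,
mutually independent, and the key is independent of them. -/
def law [∀ k, MeasurableSpace (S k)] (c : MultiCode L N S n M) (P : ∀ k, Measure (S k)) :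
    Measure (((k : Fin (L - N)) → Fin n → S k) × c.Key) :=
  (Measure.pi fun k => Measure.pi fun _ : Fin n => P k).prod c.keyLaw

/-- The encoder outputs `X_U = (X_l)_{l ∈ U}` as a random variable. -/
def output (c : MultiCode L N S n M) (U : Finset (Fin L))
    (ω : ((k : Fin (L - N)) → Fin n → S k) × c.Key) : (l : U) → Fin (M l) :=
  fun l => c.enc l ω.1 ω.2

/-- Rate constraints, reconstruction of the first `|U| - N` sources up to error probability `ε`,
and perfect secrecy of all sources against any `N` encoder outputs. -/
structure Meets [∀ k, Fintype (S k)] [∀ k, MeasurableSpace (S k)] (c : MultiCode L N S n M)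
    (P : ∀ k, Measure (S k)) (R : Fin L → ℝ) (ε : ℝ) : Prop where
  rate : ∀ l, 1 / (n : ℝ) * Real.log (M l) ≤ R l + ε
  reconstruct : ∀ (U : Finset (Fin L)) (hU : N + 1 ≤ U.card),
    (c.law P).real {ω | c.dec U hU (c.output U ω) ≠ fun k => ω.1 (Subtype.val k)} ≤ ε
  secret : ∀ A : Finset (Fin L), A.card ≤ N →
    condEntropy (c.law P) Prod.fst (c.output A) = entropy (c.law P) Prod.fst

end MultiCode

/-- The admissible rate region of the `(L, N)` secure multilevel problem. -/
def admissibleRegion (L N : ℕ) {S : Fin (L - N) → Type u} [∀ k, Fintype (S k)]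
    [∀ k, MeasurableSpace (S k)] (P : ∀ k, Measure (S k)) : Set (Fin L → ℝ) :=
  {R | (∀ l, 0 ≤ R l) ∧ ∀ ε > 0, ∀ᶠ n : ℕ in Filter.atTop,
    ∃ (M : Fin L → ℕ) (c : MultiCode L N S n M), c.Meets P R ε}

/-- Superposition: source number `k + 1` is encoded separately, with its own independent key, by
an `(L, N, N + (k + 1))` single-level code, and the output of encoder `l` is the tuple of the `L - N`
component outputs (as an element of `{1, …, ∏ k, M k l}`). -/
def superposition {L N : ℕ} {S : Fin (L - N) → Type u} {n : ℕ} {M : Fin (L - N) → Fin L → ℕ}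
    (c : ∀ k : Fin (L - N), SingleCode L (N + (k + 1)) (S k) n (M k)) :
    MultiCode L N S n (fun l => ∏ k, M k l) where
  Key := ∀ k, (c k).Key
  instMeas := inferInstance
  keyLaw := Measure.pi fun k => (c k).keyLaw
  instProb := inferInstance
  enc l s κ := finPiFinEquiv fun k => (c k).enc l (s k) (κ k)
  measurable_enc l s :=
    Measurable.of_discrete.comp
      (measurable_pi_lambda _ fun k =>
        ((c k).measurable_enc l (s k)).comp (measurable_pi_apply k))
  dec U _ y k := (c k).dec U k.2 fun l => finPiFinEquiv.symm (y l) k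

/-- The rate tuples that superposition coding achieves in the `(L, N)` secure multilevel problem:
sums of component rate tuples `r k`, achieved by superposing single-level codes of component
rates `r k`. -/
def superpositionRegion (L N : ℕ) {S : Fin (L - N) → Type u} [∀ k, Fintype (S k)]
    [∀ k, MeasurableSpace (S k)] (P : ∀ k, Measure (S k)) : Set (Fin L → ℝ) :=
  {R | ∃ r : Fin (L - N) → Fin L → ℝ, (∀ k l, 0 ≤ r k l) ∧ R = ∑ k, r k ∧
    ∀ ε > 0, ∀ᶠ n : ℕ in Filter.atTop,
      ∃ (M : Fin (L - N) → Fin L → ℕ) (c : ∀ k : Fin (L - N), SingleCode L (N + (k + 1)) (S k) n (M k)),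
        (∀ k, (c k).Meets (P k) N (r k) ε) ∧ (superposition c).Meets P R ε}

end SecureDiversity

end

-- Converse. Let H_k(U) be the joint entropy of the first k sources and the outputs in U
-- (`jointEntropy`), a monotone submodular function of U, and let F_k(t) be its sum over the L
-- cyclic intervals of length t. Submodularity makes F_k concave in t. Since N outputs are
-- independent of the sources, revealing source k+1 raises F_k(N) by at least nL·H(S_{k+1}); since
-- N+k+1 outputs decode it, the same step raises F_k(N+k+1) only by a Fano error. So the chord of
-- F_k from N to N+k+1 loses slope about nL·H(S_{k+1})/(k+1), and by concavity its slope does not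
-- grow when it is extended by one before the next source is revealed. The initial slope is at most
-- the sum of the H(X_l), the final one is nonnegative, and the losses add up to the bound
-- (`sum_le_sum_singleton_of_submodular`). Dividing by n and letting ε tend to 0 gives the converse.
--
-- Achievability. The typical sequences of S_k (`exists_typicalSet`) inject into k symbols of a
-- prime field with log p ≈ n·H(S_k)/k. These symbols become the high coefficients of a polynomial
-- whose N low coefficients are a uniform key, and the shares are its values at L distinct points.
-- Any N+k values determine the polynomial; at most N values are perfectly masked
-- (`exists_rampCode`). Each share has rate H(S_k)/k, and independent keys let the component codes
-- be superposed (`superposition_meets`).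

namespace SecureDiversity

/-! ### Entropy calculus -/

section Entropy

variable {Ω α β γ : Type*} [MeasurableSpace Ω] {μ : Measure Ω}

/-- Change of variables. It allows all entropies in one inequality to be written as sums against the
law of a single finest variable, and then compared term by term. -/
theorem sum_measureReal_preimage_mul [IsFiniteMeasure μ] [Fintype β] [MeasurableSpace β]
    [MeasurableSingletonClass β] {Z : Ω → β} (hZ : Measurable Z) [Fintype α] (g : β → α)
    (f : α → ℝ) :
    ∑ x, μ.real ((fun ω => g (Z ω)) ⁻¹' {x}) * f x = ∑ z, μ.real (Z ⁻¹' {z}) * f (g z) := by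
  classical
  rw [← Finset.sum_fiberwise (s := Finset.univ) (g := g)]
  refine Finset.sum_congr rfl fun x _ => ?_
  have h := sum_measureReal_preimage_singleton (μ := μ) (Finset.univ.filter fun z => g z = x)
    (f := Z) fun z _ => hZ (measurableSet_singleton z)
  have hset : Z ⁻¹' ((Finset.univ.filter fun z => g z = x : Finset β) : Set β)
      = (fun ω => g (Z ω)) ⁻¹' {x} := by
    ext ω; simp
  rw [hset] at h
  rw [← h, Finset.sum_mul]
  refine Finset.sum_congr rfl fun z hz => ?_
  rw [(Finset.mem_filter.1 hz).2]

theorem sum_measureReal_preimage_univ [IsProbabilityMeasure μ] [Fintype β] [MeasurableSpace β]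
    [MeasurableSingletonClass β] {Z : Ω → β} (hZ : Measurable Z) :
    ∑ z, μ.real (Z ⁻¹' {z}) = 1 := by
  have h := sum_measureReal_preimage_singleton (μ := μ) Finset.univ
    (f := Z) fun z _ => hZ (measurableSet_singleton z)
  simpa using h

/-- A marginal of a joint law. -/
theorem sum_measureReal_prodMk_preimage [IsFiniteMeasure μ] [Fintype α] [MeasurableSpace α]
    [MeasurableSingletonClass α] [Fintype β] [MeasurableSpace β] [MeasurableSingletonClass β]
    {X : Ω → α} {Y : Ω → β} (hX : Measurable X) (hY : Measurable Y) (y : β) :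
    ∑ x, μ.real ((fun ω => (X ω, Y ω)) ⁻¹' {(x, y)}) = μ.real (Y ⁻¹' {y}) := by
  classical
  have h := sum_measureReal_preimage_mul (μ := μ) (hX.prodMk hY) Prod.snd
    (fun y' => if y' = y then (1 : ℝ) else 0)
  simp only [Fintype.sum_prod_type, mul_ite, mul_one, mul_zero, Finset.sum_ite_eq',
    Finset.mem_univ, if_true] at h
  exact h.symm

theorem measureReal_preimage_le_comp [IsFiniteMeasure μ] (Z : Ω → β) (g : β → α) (z : β) :
    μ.real (Z ⁻¹' {z}) ≤ μ.real ((fun ω => g (Z ω)) ⁻¹' {g z}) :=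
  measureReal_mono fun ω hω => by simp_all

/-- The entropy of a function of `Z` as a sum over the values of `Z`. -/
theorem entropy_comp_eq [IsFiniteMeasure μ] [Fintype β] [MeasurableSpace β]
    [MeasurableSingletonClass β] {Z : Ω → β} (hZ : Measurable Z) [Fintype α] (g : β → α) :
    entropy μ (fun ω => g (Z ω))
      = ∑ z, μ.real (Z ⁻¹' {z}) * -Real.log (μ.real ((fun ω => g (Z ω)) ⁻¹' {g z})) := by
  rw [← sum_measureReal_preimage_mul hZ g
    fun x => -Real.log (μ.real ((fun ω => g (Z ω)) ⁻¹' {x}))]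
  simp [entropy, Real.negMulLog]

theorem entropy_eq_sum [Fintype β] (Z : Ω → β) :
    entropy μ Z = ∑ z, μ.real (Z ⁻¹' {z}) * -Real.log (μ.real (Z ⁻¹' {z})) := by
  simp [entropy, Real.negMulLog]

theorem entropy_nonneg [IsProbabilityMeasure μ] [Fintype α] (X : Ω → α) : 0 ≤ entropy μ X :=
  Finset.sum_nonneg fun _ _ => Real.negMulLog_nonneg measureReal_nonneg measureReal_le_one

/-- Entropy does not increase under maps. -/
theorem entropy_comp_le [IsProbabilityMeasure μ] [Fintype β] [MeasurableSpace β]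
    [MeasurableSingletonClass β] {Z : Ω → β} (hZ : Measurable Z) [Fintype α] (g : β → α) :
    entropy μ (fun ω => g (Z ω)) ≤ entropy μ Z := by
  rw [entropy_comp_eq hZ, entropy_eq_sum]
  refine Finset.sum_le_sum fun z _ => ?_
  rcases (measureReal_nonneg (μ := μ) (s := Z ⁻¹' {z})).eq_or_lt with h | h
  · simp [← h]
  · exact mul_le_mul_of_nonneg_left
      (neg_le_neg (Real.log_le_log h (measureReal_preimage_le_comp Z g z))) h.le

/-- `X` factors through `Z`, with arbitrary values off the range. Rearranging, dropping or
duplicating components of a tuple is always handled this way. -/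
theorem entropy_le_of_determines [IsProbabilityMeasure μ] [Fintype β] [MeasurableSpace β]
    [MeasurableSingletonClass β] {Z : Ω → β} (hZ : Measurable Z) [Fintype α] {X : Ω → α}
    (h : ∀ ω ω', Z ω = Z ω' → X ω = X ω') : entropy μ X ≤ entropy μ Z := by
  have : Nonempty Ω := μ.nonempty_of_neZero
  have : Nonempty α := this.map X
  have hX : X = fun ω => Function.extend Z X (fun _ => Classical.arbitrary α) (Z ω) := by
    funext ω
    exact (Function.FactorsThrough.extend_apply (fun a b hab => h a b hab) _ ω).symm
  rw [hX]
  exact entropy_comp_le hZ _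

/-- Gibbs' inequality, from log t ≤ t - 1 at t = q/p. Submodularity, Fano's inequality and the
cardinality bound all follow from it by a choice of `q`. -/
theorem sum_mul_neg_log_le {ι : Type*} [Fintype ι] {p q : ι → ℝ} (hp : ∀ i, 0 ≤ p i)
    (hq : ∀ i, 0 ≤ q i) (hpq : ∀ i, q i = 0 → p i = 0) (hsum : ∑ i, q i ≤ ∑ i, p i) :
    ∑ i, p i * -Real.log (p i) ≤ ∑ i, p i * -Real.log (q i) := by
  have key : ∀ i, p i * -Real.log (p i) + p i * Real.log (q i) ≤ q i - p i := by
    intro i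
    rcases (hp i).eq_or_lt with h | h
    · simp [← h, hq i]
    · have hqi : 0 < q i := (hq i).lt_of_ne fun h0 => h.ne' (hpq i h0.symm)
      have h1 := Real.log_le_sub_one_of_pos (div_pos hqi h)
      rw [Real.log_div hqi.ne' h.ne'] at h1
      have h2 := mul_le_mul_of_nonneg_left h1 h.le
      rw [mul_sub, mul_sub, mul_div_cancel₀ _ h.ne'] at h2
      linarith
  have h := Finset.sum_le_sum fun i (_ : i ∈ Finset.univ) => key i
  simp only [Finset.sum_add_distrib, Finset.sum_sub_distrib] at h
  have : ∑ i, p i * -Real.log (q i) = - ∑ i, p i * Real.log (q i) := by simp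
  linarith

theorem entropy_le_log_card [IsProbabilityMeasure μ] [Fintype α] [MeasurableSpace α]
    [MeasurableSingletonClass α] {X : Ω → α} (hX : Measurable X) :
    entropy μ X ≤ Real.log (Fintype.card α) := by
  have : Nonempty Ω := μ.nonempty_of_neZero
  have : Nonempty α := this.map X
  have hc : (0 : ℝ) < Fintype.card α := by exact_mod_cast Fintype.card_pos
  have h1 := sum_measureReal_preimage_univ (μ := μ) hX
  rw [entropy_eq_sum]
  refine (sum_mul_neg_log_le (q := fun _ => (Fintype.card α : ℝ)⁻¹) (fun _ => measureReal_nonneg)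
    (fun _ => (inv_pos.2 hc).le) (fun _ h => absurd h (inv_pos.2 hc).ne') ?_).trans ?_
  · rw [h1]; simp [hc.ne']
  · rw [← Finset.sum_mul, h1]; simp

/-- Submodularity: `H(X, Y, W) + H(W) ≤ H(X, W) + H(Y, W)`. -/
theorem entropy_submodular [IsProbabilityMeasure μ] [Fintype α] [MeasurableSpace α]
    [MeasurableSingletonClass α] [Fintype β] [MeasurableSpace β] [MeasurableSingletonClass β]
    [Fintype γ] [MeasurableSpace γ] [MeasurableSingletonClass γ] {X : Ω → α} {Y : Ω → β}
    {W : Ω → γ} (hX : Measurable X) (hY : Measurable Y) (hW : Measurable W) :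
    entropy μ (fun ω => (X ω, Y ω, W ω)) + entropy μ W
      ≤ entropy μ (fun ω => (X ω, W ω)) + entropy μ (fun ω => (Y ω, W ω)) := by
  set Z : Ω → α × β × γ := fun ω => (X ω, Y ω, W ω) with hZdef
  have hZ : Measurable Z := hX.prodMk (hY.prodMk hW)
  set p : α × β × γ → ℝ := fun z => μ.real (Z ⁻¹' {z})
  set a : α → γ → ℝ := fun x w => μ.real ((fun ω => (X ω, W ω)) ⁻¹' {(x, w)})
  set b : β → γ → ℝ := fun y w => μ.real ((fun ω => (Y ω, W ω)) ⁻¹' {(y, w)})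
  set c : γ → ℝ := fun w => μ.real (W ⁻¹' {w})
  have ha0 : ∀ x w, 0 ≤ a x w := fun _ _ => measureReal_nonneg
  have hb0 : ∀ x w, 0 ≤ b x w := fun _ _ => measureReal_nonneg
  have hc0 : ∀ w, 0 ≤ c w := fun _ => measureReal_nonneg
  have hpa : ∀ z : α × β × γ, p z ≤ a z.1 z.2.2 := fun z =>
    measureReal_preimage_le_comp Z (fun z => (z.1, z.2.2)) z
  have hpb : ∀ z : α × β × γ, p z ≤ b z.2.1 z.2.2 := fun z =>
    measureReal_preimage_le_comp Z (fun z => z.2) z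
  have hpc : ∀ z : α × β × γ, p z ≤ c z.2.2 := fun z =>
    measureReal_preimage_le_comp Z (fun z => z.2.2) z
  have hasum : ∀ w, ∑ x, a x w = c w := sum_measureReal_prodMk_preimage hX hW
  have hbsum : ∀ w, ∑ y, b y w = c w := sum_measureReal_prodMk_preimage hY hW
  have hW1 : entropy μ W = ∑ z, p z * -Real.log (c z.2.2) :=
    entropy_comp_eq hZ fun z => z.2.2
  have hXW : entropy μ (fun ω => (X ω, W ω)) = ∑ z, p z * -Real.log (a z.1 z.2.2) :=
    entropy_comp_eq hZ fun z => (z.1, z.2.2)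
  have hYW : entropy μ (fun ω => (Y ω, W ω)) = ∑ z, p z * -Real.log (b z.2.1 z.2.2) :=
    entropy_comp_eq hZ fun z => z.2
  -- The comparison law has the same pairs (X, W) and (Y, W), but X and Y conditionally independent
  -- given W.
  have hG := sum_mul_neg_log_le (p := p)
    (q := fun z => a z.1 z.2.2 * b z.2.1 z.2.2 / c z.2.2) (fun _ => measureReal_nonneg)
    (fun z => div_nonneg (mul_nonneg (ha0 _ _) (hb0 _ _)) (hc0 _)) ?_ ?_
  · have hZ1 : entropy μ Z = ∑ z, p z * -Real.log (p z) := entropy_eq_sum Z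
    rw [hZ1, hW1, hXW, hYW]
    refine (add_le_add hG le_rfl).trans_eq ?_
    rw [← Finset.sum_add_distrib, ← Finset.sum_add_distrib]
    refine Finset.sum_congr rfl fun z _ => ?_
    have hp0 : 0 ≤ p z := measureReal_nonneg
    rcases hp0.eq_or_lt with h | h
    · simp [← h]
    · have h1 := h.trans_le (hpa z)
      have h2 := h.trans_le (hpb z)
      have h3 := h.trans_le (hpc z)
      rw [Real.log_div (mul_pos h1 h2).ne' h3.ne', Real.log_mul h1.ne' h2.ne']
      ring
  · intro z h
    have hp0 : 0 ≤ p z := measureReal_nonneg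
    by_contra hne
    have hpos : 0 < p z := hp0.lt_of_ne (Ne.symm hne)
    have := hpos.trans_le (hpa z)
    have := hpos.trans_le (hpb z)
    have := hpos.trans_le (hpc z)
    exact absurd h (by positivity)
  · have h1 : ∑ z, p z = 1 := sum_measureReal_preimage_univ hZ
    rw [h1]
    have h2 : ∑ w, c w = 1 := sum_measureReal_preimage_univ hW
    rw [← h2]
    rw [Fintype.sum_prod_type]
    simp_rw [Fintype.sum_prod_type]
    have : ∀ x, ∑ y, ∑ w, a x w * b y w / c w = ∑ w, a x w * (c w / c w) := by
      intro x
      rw [Finset.sum_comm]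
      refine Finset.sum_congr rfl fun w _ => ?_
      rw [← hbsum w, ← mul_div_assoc, Finset.mul_sum, Finset.sum_div]
    simp_rw [this]
    rw [Finset.sum_comm]
    -- Where `c w = 0` the quotient `c w / c w` is 0, hence an inequality; mass at most 1 is all
    -- that is needed.
    refine Finset.sum_le_sum fun w _ => ?_
    rw [← Finset.sum_mul, hasum]
    exact mul_le_of_le_one_right (hc0 w) (div_self_le_one _)

/-- A form of Fano's inequality. -/
theorem entropy_prod_le_of_decoder [IsProbabilityMeasure μ] [Fintype α] [MeasurableSpace α]
    [MeasurableSingletonClass α] [Fintype β] [MeasurableSpace β] [MeasurableSingletonClass β]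
    {X : Ω → α} {Y : Ω → β} (hX : Measurable X) (hY : Measurable Y) (d : β → α) :
    entropy μ (fun ω => (X ω, Y ω)) ≤ entropy μ Y + Real.log 2
      + μ.real {ω | d (Y ω) ≠ X ω} * Real.log (Fintype.card α) := by
  classical
  have : Nonempty Ω := μ.nonempty_of_neZero
  have : Nonempty α := this.map X
  have hc : (0 : ℝ) < Fintype.card α := by exact_mod_cast Fintype.card_pos
  set Z : Ω → α × β := fun ω => (X ω, Y ω)
  have hZ : Measurable Z := hX.prodMk hY
  set p : α × β → ℝ := fun z => μ.real (Z ⁻¹' {z})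
  set b : β → ℝ := fun y => μ.real (Y ⁻¹' {y})
  have hpb : ∀ z : α × β, p z ≤ b z.2 := fun z => measureReal_preimage_le_comp Z Prod.snd z
  have hb0 : ∀ y, 0 ≤ b y := fun _ => measureReal_nonneg
  have hp0 : ∀ y, 0 ≤ p y := fun _ => measureReal_nonneg
  -- Half a point mass at the decoder's guess plus half the uniform law. It costs at most log 2 when
  -- the guess is right and log 2 + log |α| when it is wrong.
  set r : α × β → ℝ := fun z =>
    (if d z.2 = z.1 then 1 / 2 else 0) + 1 / (2 * (Fintype.card α : ℝ)) with hr
  have hr0 : ∀ z, 0 < r z := fun z => by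
    simp only [hr]; split_ifs <;> positivity
  have hlog : ∀ z, -Real.log (r z)
      ≤ Real.log 2 + (if d z.2 ≠ z.1 then 1 else 0) * Real.log (Fintype.card α) := by
    intro z
    by_cases h : d z.2 = z.1
    · simp only [hr, h, if_true, ne_eq, not_true, if_false, zero_mul, add_zero]
      rw [neg_le, ← Real.log_inv]
      apply Real.log_le_log (by norm_num)
      have : (0 : ℝ) < 1 / (2 * (Fintype.card α : ℝ)) := by positivity
      linarith
    · simp only [hr, h, if_false, ne_eq, not_false_eq_true, if_true, one_mul, zero_add]
      rw [one_div, Real.log_inv, Real.log_mul two_ne_zero hc.ne', neg_neg]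
  have hY1 : entropy μ Y = ∑ z, p z * -Real.log (b z.2) := entropy_comp_eq hZ Prod.snd
  have herr : μ.real {ω | d (Y ω) ≠ X ω} = ∑ z, p z * (if d z.2 ≠ z.1 then 1 else 0) := by
    have h := sum_measureReal_preimage_mul (μ := μ) hZ (fun z => decide (d z.2 ≠ z.1))
      (fun t => if t = true then (1 : ℝ) else 0)
    simp only [Fintype.sum_bool, if_true, Bool.false_eq_true, if_false, mul_zero, add_zero,
      mul_one, decide_eq_true_eq] at h
    rw [← h]
    congr 1
    ext ω; simp [Z]
  have h1 : ∑ z, p z = 1 := sum_measureReal_preimage_univ hZ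
  have hG := sum_mul_neg_log_le (p := p) (q := fun z => b z.2 * r z) hp0
    (fun z => mul_nonneg (hb0 _) (hr0 z).le) ?_ ?_
  · have hZ1 : entropy μ Z = ∑ z, p z * -Real.log (p z) := entropy_eq_sum Z
    rw [hZ1, hY1, herr]
    refine hG.trans ?_
    have : Real.log 2 = ∑ z, p z * Real.log 2 := by rw [← Finset.sum_mul, h1, one_mul]
    rw [this, Finset.sum_mul, ← Finset.sum_add_distrib, ← Finset.sum_add_distrib]
    refine Finset.sum_le_sum fun z _ => ?_
    rcases (hp0 z).eq_or_lt with h | h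
    · simp [← h]
    · rw [Real.log_mul (h.trans_le (hpb z)).ne' (hr0 z).ne']
      have := mul_le_mul_of_nonneg_left (hlog z) h.le
      linarith
  · intro z h
    rcases mul_eq_zero.1 h with h | h
    · exact le_antisymm (h ▸ hpb z) (hp0 z)
    · exact absurd h (hr0 z).ne'
  · have h2 : ∑ w, b w = 1 := sum_measureReal_preimage_univ hY
    rw [h1, ← h2, Fintype.sum_prod_type, Finset.sum_comm]
    refine le_of_eq (Finset.sum_congr rfl fun y _ => ?_)
    change ∑ x, b y * r (x, y) = b y
    rw [← Finset.mul_sum]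
    simp only [hr, Finset.sum_add_distrib, Finset.sum_ite_eq, Finset.mem_univ, if_true]
    simp only [Finset.sum_const, Finset.card_univ, nsmul_eq_mul]
    field_simp
    norm_num

/-- The entropy of a family of independent variables. -/
theorem entropy_pi_of_iIndepFun [IsProbabilityMeasure μ] {ι : Type*} [Fintype ι] [DecidableEq ι]
    {T : ι → Type*}
    [∀ i, Fintype (T i)] [∀ i, MeasurableSpace (T i)] [∀ i, MeasurableSingletonClass (T i)]
    {Y : ∀ i, Ω → T i} (hY : ∀ i, Measurable (Y i)) (h : iIndepFun Y μ) :
    entropy μ (fun ω i => Y i ω) = ∑ i, entropy μ (Y i) := by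
  set Z : Ω → ∀ i, T i := fun ω i => Y i ω
  have hZ : Measurable Z := measurable_pi_lambda _ hY
  have hp : ∀ z : ∀ i, T i, μ.real (Z ⁻¹' {z}) = ∏ i, μ.real (Y i ⁻¹' {z i}) := by
    intro z
    have := h.measure_inter_preimage_eq_mul Finset.univ (sets := fun i => {z i})
      fun i _ => measurableSet_singleton _
    simp only [measureReal_def, ← ENNReal.toReal_prod, ← this]
    congr 2
    ext ω
    simp [Z, funext_iff]
  have hi : ∀ i, entropy μ (Y i)
      = ∑ z, μ.real (Z ⁻¹' {z}) * -Real.log (μ.real (Y i ⁻¹' {z i})) :=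
    fun i => entropy_comp_eq hZ fun z => z i
  simp_rw [hi]
  rw [Finset.sum_comm, entropy_eq_sum]
  refine Finset.sum_congr rfl fun z _ => ?_
  rw [← Finset.mul_sum]
  by_cases h0 : μ.real (Z ⁻¹' {z}) = 0
  · simp [h0]
  · rw [hp, Real.log_prod, Finset.sum_neg_distrib]
    intro i hi hi0
    exact h0 (by rw [hp]; exact Finset.prod_eq_zero hi hi0)

/-- The chain rule. -/
theorem condEntropy_add_entropy [IsProbabilityMeasure μ] [Fintype α] [MeasurableSpace α]
    [MeasurableSingletonClass α] [Fintype β] [MeasurableSpace β] [MeasurableSingletonClass β]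
    {X : Ω → α} {Y : Ω → β} (hX : Measurable X) (hY : Measurable Y) :
    condEntropy μ X Y + entropy μ Y = entropy μ (fun ω => (X ω, Y ω)) := by
  set Z : Ω → α × β := fun ω => (X ω, Y ω)
  have hZ : Measurable Z := hX.prodMk hY
  have hY1 : entropy μ Y = ∑ z, μ.real (Z ⁻¹' {z}) * -Real.log (μ.real (Y ⁻¹' {z.2})) :=
    entropy_comp_eq hZ Prod.snd
  rw [hY1, entropy_eq_sum Z, Fintype.sum_prod_type, Fintype.sum_prod_type, Finset.sum_comm,
    Finset.sum_comm (f := fun x y => μ.real (Z ⁻¹' {(x, y)}) * -Real.log (μ.real (Z ⁻¹' {(x, y)}))),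
    condEntropy, ← Finset.sum_add_distrib]
  refine Finset.sum_congr rfl fun y _ => ?_
  rw [entropy, Finset.mul_sum, ← Finset.sum_add_distrib]
  refine Finset.sum_congr rfl fun x _ => ?_
  have hset : Y ⁻¹' {y} ∩ X ⁻¹' {x} = Z ⁻¹' {(x, y)} := by
    ext ω; simp [Z, and_comm]
  have hcond : (cond μ (Y ⁻¹' {y})).real (X ⁻¹' {x})
      = (μ.real (Y ⁻¹' {y}))⁻¹ * μ.real (Z ⁻¹' {(x, y)}) := by
    rw [measureReal_def, cond_apply (hY (measurableSet_singleton y)), hset, ENNReal.toReal_mul,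
      ENNReal.toReal_inv, ← measureReal_def, ← measureReal_def]
  rw [hcond]
  set p := μ.real (Z ⁻¹' {(x, y)}) with hp
  set b := μ.real (Y ⁻¹' {y})
  have hpb : p ≤ b := measureReal_preimage_le_comp Z Prod.snd (x, y)
  have hp0 : 0 ≤ p := measureReal_nonneg
  rcases hp0.eq_or_lt with h | h
  · simp [← h]
  · have hb := h.trans_le hpb
    rw [Real.negMulLog, Real.log_mul (inv_pos.2 hb).ne' h.ne', Real.log_inv]
    field_simp
    ring

theorem entropy_comp_measurePreserving {Ω' : Type*} [MeasurableSpace Ω'] {ν : Measure Ω'}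
    {f : Ω → Ω'} (hf : MeasurePreserving f μ ν) [Fintype α] [MeasurableSpace α]
    [MeasurableSingletonClass α] {X : Ω' → α} (hX : Measurable X) :
    entropy μ (fun ω => X (f ω)) = entropy ν X := by
  unfold entropy
  refine Finset.sum_congr rfl fun x _ => ?_
  rw [← hf.measureReal_preimage (hX (measurableSet_singleton x)).nullMeasurableSet]
  rfl

/-- The entropy of a subfamily of the coordinates of a product measure. -/
theorem entropy_pi_restrict {ι : Type*} [Fintype ι] [DecidableEq ι] {T : ι → Type*}
    [∀ i, Fintype (T i)] [∀ i, MeasurableSpace (T i)] [∀ i, MeasurableSingletonClass (T i)]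
    (P : ∀ i, Measure (T i)) [∀ i, IsProbabilityMeasure (P i)] (p : ι → Prop) [DecidablePred p] :
    entropy (Measure.pi P) (fun s (i : {i // p i}) => s i)
      = ∑ i with p i, entropy (P i) id := by
  have hind : iIndepFun (fun i (s : ∀ i, T i) => s i) (Measure.pi P) :=
    iIndepFun_pi (X := fun i => id) fun i => aemeasurable_id
  rw [entropy_pi_of_iIndepFun (Y := fun (i : {i // p i}) (s : ∀ i, T i) => s i)
    (fun i => measurable_pi_apply _) (hind.precomp Subtype.val_injective)]
  rw [← Finset.sum_subtype (p := p) (Finset.univ.filter p) (by simp)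
    (fun i => entropy (Measure.pi P) (fun s : ∀ i, T i => s i))]
  refine Finset.sum_congr rfl fun i _ => ?_
  exact entropy_comp_measurePreserving (measurePreserving_eval P i) (X := id) measurable_id

theorem entropy_pi_const {T : Type*} [Fintype T] [MeasurableSpace T] [MeasurableSingletonClass T]
    (P : Measure T) [IsProbabilityMeasure P] (n : ℕ) :
    entropy (Measure.pi fun _ : Fin n => P) id = n * entropy P id := by
  have hind : iIndepFun (fun i (s : Fin n → T) => s i) (Measure.pi fun _ => P) :=
    iIndepFun_pi (X := fun i => id) fun i => aemeasurable_id
  have h := entropy_pi_of_iIndepFun (fun i => measurable_pi_apply i) hind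
  have hi : ∀ i : Fin n, entropy (Measure.pi fun _ : Fin n => P) (fun s => s i) = entropy P id :=
    fun i => entropy_comp_measurePreserving (measurePreserving_eval (fun _ : Fin n => P) i)
      (X := id) measurable_id
  simp only [hi, Finset.sum_const, Finset.card_univ, Fintype.card_fin, nsmul_eq_mul] at h
  exact h

end Entropy

end SecureDiversity

namespace SecureDiversity

/-! ### An averaging inequality for submodular set functions -/

section Cyclic

variable {L : ℕ}

/-- The cyclic interval of length `t` starting at `j`. -/
def cyclicInterval (j : Fin L) (t : ℕ) : Finset (Fin L) :=
  Finset.univ.filter fun l => (l - j).val < t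

theorem mem_cyclicInterval {j l : Fin L} {t : ℕ} : l ∈ cyclicInterval j t ↔ (l - j).val < t := by
  simp [cyclicInterval]

theorem cyclicInterval_zero (j : Fin L) : cyclicInterval j 0 = ∅ := by
  simp [cyclicInterval]

theorem cyclicInterval_mono (j : Fin L) {s t : ℕ} (h : s ≤ t) :
    cyclicInterval j s ⊆ cyclicInterval j t := fun l hl => by
  rw [mem_cyclicInterval] at *
  omega

variable [NeZero L]

theorem card_cyclicInterval (j : Fin L) {t : ℕ} (ht : t ≤ L) : (cyclicInterval j t).card = t := by
  have h : (cyclicInterval j t).map (Equiv.subRight j).toEmbedding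
      = Finset.univ.filter fun l : Fin L => l.val < t := by
    ext l
    simp only [Finset.mem_map_equiv, mem_cyclicInterval, Finset.mem_filter, Finset.mem_univ,
      true_and, Equiv.subRight_symm_apply, add_sub_cancel_right]
  rw [← Finset.card_map, h, Fin.card_filter_val_lt, min_eq_right ht]

theorem cyclicInterval_one (j : Fin L) : cyclicInterval j 1 = {j} := by
  ext l
  rw [mem_cyclicInterval, Finset.mem_singleton, Nat.lt_one_iff, Fin.val_eq_zero_iff, sub_eq_zero]

theorem val_sub_le_add_one (j l : Fin L) : (l - j).val ≤ (l - (j + 1)).val + 1 := by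
  have h : l - j = (l - (j + 1)) + 1 := by abel
  rw [h, Fin.val_add]
  refine (Nat.mod_le _ _).trans (Nat.add_le_add_left ?_ _)
  rw [Fin.val_one']
  exact Nat.mod_le _ _

theorem val_sub_add_one_eq {j l : Fin L} (h : l ≠ j) : (l - (j + 1)).val + 1 = (l - j).val := by
  have hne : l - j ≠ 0 := sub_ne_zero.2 h
  have h1 : l - (j + 1) = (l - j) - 1 := by abel
  rw [h1]
  have hpos : 0 < (l - j).val := Nat.pos_of_ne_zero fun h0 => hne (Fin.val_eq_zero_iff.1 h0)
  have := Fin.val_sub_one_of_ne_zero hne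
  omega

theorem cyclicInterval_succ_subset (j : Fin L) (t : ℕ) :
    cyclicInterval (j + 1) t ⊆ cyclicInterval j (t + 1) ∩ cyclicInterval (j + 1) (t + 1) := by
  intro l hl
  rw [Finset.mem_inter]
  refine ⟨?_, cyclicInterval_mono _ (Nat.le_succ t) hl⟩
  rw [mem_cyclicInterval] at *
  have := val_sub_le_add_one j l
  omega

theorem cyclicInterval_subset_union (j : Fin L) (t : ℕ) :
    cyclicInterval j (t + 2) ⊆ cyclicInterval j (t + 1) ∪ cyclicInterval (j + 1) (t + 1) := by
  intro l hl
  rw [Finset.mem_union]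
  by_cases h : l = j
  · left; rw [mem_cyclicInterval, h, sub_self]; simp
  · right
    rw [mem_cyclicInterval] at *
    have := val_sub_add_one_eq h
    omega

/-- The sum of a set function over all cyclic intervals of a given length is concave in the
length, if the function is monotone and submodular. -/
theorem sum_cyclicInterval_concave {h : Finset (Fin L) → ℝ} (hmono : Monotone h)
    (hsub : ∀ U V, h (U ∪ V) + h (U ∩ V) ≤ h U + h V) (t : ℕ) :
    ∑ j, h (cyclicInterval j (t + 2)) - ∑ j, h (cyclicInterval j (t + 1))
      ≤ ∑ j, h (cyclicInterval j (t + 1)) - ∑ j, h (cyclicInterval j t) := by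
  have shift : ∀ s, ∑ j, h (cyclicInterval (j + 1) s) = ∑ j, h (cyclicInterval j s) := fun s =>
    Equiv.sum_comp (Equiv.addRight (1 : Fin L)) fun j => h (cyclicInterval j s)
  -- Two neighbouring intervals of length t+1 cover one of length t+2 and overlap in at least one of
  -- length t. Inclusions suffice by monotonicity and remain valid when lengths exceed L; length L+1
  -- does occur later.
  have key : ∀ j, h (cyclicInterval j (t + 2)) + h (cyclicInterval (j + 1) t)
      ≤ h (cyclicInterval j (t + 1)) + h (cyclicInterval (j + 1) (t + 1)) := fun j =>
    (add_le_add (hmono (cyclicInterval_subset_union j t))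
      (hmono (cyclicInterval_succ_subset j t))).trans (hsub _ _)
  have := Finset.sum_le_sum fun j (_ : j ∈ Finset.univ) => key j
  simp only [Finset.sum_add_distrib, shift] at this
  linarith

/-- Here `h k` stands for the joint entropy with the first k sources, `a k` for the entropy of the
next source and `δ` for the Fano error; `hdec` expresses decodability and `hsec` secrecy. -/
theorem sum_le_sum_singleton_of_submodular {N : ℕ} (hNL : N ≤ L) (h : ℕ → Finset (Fin L) → ℝ)
    (hmono : ∀ k, Monotone (h k)) (hsub : ∀ k U V, h k (U ∪ V) + h k (U ∩ V) ≤ h k U + h k V)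
    (h0 : 0 ≤ h 0 ∅) (a : ℕ → ℝ) (δ : ℝ)
    (hdec : ∀ k < L - N, ∀ U, U.card = N + k + 1 → h (k + 1) U ≤ h k U + δ)
    (hsec : ∀ k < L - N, ∀ A, A.card = N → h k A + a k ≤ h (k + 1) A) :
    ∑ k ∈ Finset.range (L - N), (L : ℝ) / ((k : ℝ) + 1) * (a k - δ) ≤ ∑ l, h 0 {l} := by
  set F : ℕ → ℕ → ℝ := fun k t => ∑ j, h k (cyclicInterval j t) with hF
  have hanti : ∀ k, Antitone fun t => F k (t + 1) - F k t := fun k =>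
    antitone_nat_of_succ_le fun t => sum_cyclicInterval_concave (hmono k) (hsub k) t
  have hFmono : ∀ k, Monotone (F k) := fun k s t hst =>
    Finset.sum_le_sum fun j _ => hmono k (cyclicInterval_mono j hst)
  -- By concavity, the next increment is at most the average of the s increments since N.
  have havg : ∀ k s : ℕ, (s : ℝ) * (F k (N + s + 1) - F k (N + s)) ≤ F k (N + s) - F k N := by
    intro k s
    induction s with
    | zero => simp
    | succ s ih =>
      have h1 : F k (N + (s + 1) + 1) - F k (N + (s + 1)) ≤ F k (N + s + 1) - F k (N + s) :=
        hanti k (Nat.le_succ (N + s))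
      have h2 : ((s : ℝ) + 1) * (F k (N + (s + 1) + 1) - F k (N + (s + 1)))
          ≤ ((s : ℝ) + 1) * (F k (N + s + 1) - F k (N + s)) :=
        mul_le_mul_of_nonneg_left h1 (by positivity)
      push_cast
      rw [← Nat.add_assoc] at h2 ⊢
      linarith
  -- Invariant: the entropy already accounted for plus the slope of the chord of `F K` from N to
  -- N+K+1.
  have main : ∀ K ≤ L - N, ∑ k ∈ Finset.range K, (L : ℝ) / ((k : ℝ) + 1) * (a k - δ)
      + (F K (N + K + 1) - F K N) / ((K : ℝ) + 1) ≤ ∑ l, h 0 {l} := by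
    intro K
    induction K with
    | zero =>
      intro _
      have h1 : F 0 (N + 1) - F 0 N ≤ F 0 (0 + 1) - F 0 0 := hanti 0 (Nat.zero_le N)
      have h2 : 0 ≤ F 0 0 := Finset.sum_nonneg fun j _ => by rw [cyclicInterval_zero]; exact h0
      have h3 : F 0 (0 + 1) = ∑ l, h 0 {l} := by simp [hF, cyclicInterval_one]
      simp only [Finset.range_zero, Finset.sum_empty, Nat.cast_zero, zero_add, add_zero, div_one]
        at *
      linarith
    | succ K ih =>
      intro hK
      refine le_trans ?_ (ih (by omega))
      rw [Finset.sum_range_succ, add_assoc, add_le_add_iff_left]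
      have hd : F (K + 1) (N + K + 1) ≤ F K (N + K + 1) + L * δ := by
        have := Finset.sum_le_sum fun j (_ : j ∈ Finset.univ) =>
          hdec K (by omega) (cyclicInterval j (N + K + 1)) (card_cyclicInterval j (by omega))
        simpa [Finset.sum_add_distrib] using this
      have hs : F K N + L * a K ≤ F (K + 1) N := by
        have := Finset.sum_le_sum fun j (_ : j ∈ Finset.univ) =>
          hsec K (by omega) (cyclicInterval j N) (card_cyclicInterval j hNL)
        simpa [Finset.sum_add_distrib] using this
      have hv := havg (K + 1) (K + 1)
      rw [← Nat.add_assoc] at hv ⊢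
      push_cast at hv ⊢
      -- Extending the chord of a concave function by one step does not increase its slope.
      have e1 : (F (K + 1) (N + K + 1 + 1) - F (K + 1) N) / ((K : ℝ) + 1 + 1)
          ≤ (F (K + 1) (N + K + 1) - F (K + 1) N) / ((K : ℝ) + 1) := by
        rw [div_le_div_iff₀ (by positivity) (by positivity)]
        linarith
      -- Passing from `F K` to `F (K + 1)` lifts the right end by at most Lδ and the left end by at
      -- least L·a_K.
      have e2 : (L : ℝ) / ((K : ℝ) + 1) * (a K - δ)
          + (F (K + 1) (N + K + 1) - F (K + 1) N) / ((K : ℝ) + 1)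
          ≤ (F K (N + K + 1) - F K N) / ((K : ℝ) + 1) := by
        rw [div_mul_eq_mul_div, ← add_div]
        apply div_le_div_of_nonneg_right _ (by positivity)
        linarith
      linarith
  have hfin := main (L - N) le_rfl
  have : 0 ≤ (F (L - N) (N + (L - N) + 1) - F (L - N) N) / (((L - N : ℕ) : ℝ) + 1) :=
    div_nonneg (sub_nonneg.2 (hFmono _ (by omega))) (by positivity)
  linarith

end Cyclic

end SecureDiversity

namespace SecureDiversity

/-! ### The converse -/

namespace MultiCode

universe u

variable {L N : ℕ} {S : Fin (L - N) → Type u} {n : ℕ} {M : Fin L → ℕ}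

section

variable [∀ k, MeasurableSpace (S k)]

instance instIsProbabilityMeasureLaw (c : MultiCode L N S n M) (P : ∀ k, Measure (S k))
    [∀ k, IsProbabilityMeasure (P k)] : IsProbabilityMeasure (c.law P) :=
  inferInstanceAs (IsProbabilityMeasure ((Measure.pi fun k => Measure.pi fun _ => P k).prod _))

theorem measurable_output [∀ k, Finite (S k)] [∀ k, MeasurableSingletonClass (S k)]
    (c : MultiCode L N S n M) (U : Finset (Fin L)) : Measurable (c.output U) :=
  measurable_pi_lambda _ fun l =>
    measurable_from_prod_countable_right fun s => c.measurable_enc l s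

theorem measurePreserving_fst_law (c : MultiCode L N S n M) (P : ∀ k, Measure (S k))
    [∀ k, IsProbabilityMeasure (P k)] :
    MeasurePreserving Prod.fst (c.law P) (Measure.pi fun k => Measure.pi fun _ : Fin n => P k) :=
  measurePreserving_fst

end

/-- The first `k` sources. -/
def firstSources (c : MultiCode L N S n M) (k : ℕ) (ω : (∀ k, Fin n → S k) × c.Key)
    (i : {i : Fin (L - N) // i.val < k}) : Fin n → S i :=
  ω.1 i

theorem output_eq_of_subset (c : MultiCode L N S n M) {U V : Finset (Fin L)} (h : U ⊆ V)
    {ω ω' : (∀ k, Fin n → S k) × c.Key}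
    (he : c.output V ω = c.output V ω') : c.output U ω = c.output U ω' := by
  funext l
  exact congrFun he ⟨l.1, h l.2⟩

theorem measurable_firstSources [∀ k, MeasurableSpace (S k)] (c : MultiCode L N S n M) (k : ℕ) :
    Measurable (c.firstSources k) :=
  measurable_pi_lambda _ fun i => (measurable_pi_apply i.1).comp measurable_fst

variable [∀ k, Fintype (S k)] [∀ k, MeasurableSpace (S k)] [∀ k, MeasurableSingletonClass (S k)]

theorem entropy_firstSources (c : MultiCode L N S n M) (P : ∀ k, Measure (S k))
    [∀ k, IsProbabilityMeasure (P k)] (k : ℕ) :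
    entropy (c.law P) (c.firstSources k)
      = ∑ i : Fin (L - N) with i.val < k, n * entropy (P i) id := by
  have h := entropy_comp_measurePreserving (c.measurePreserving_fst_law P)
    (X := fun s (i : {i : Fin (L - N) // i.val < k}) => s i.1)
    (measurable_pi_lambda _ fun i => measurable_pi_apply i.1)
  have h2 := entropy_pi_restrict (fun k => Measure.pi fun _ : Fin n => P k)
    (fun i : Fin (L - N) => i.val < k)
  simp only [entropy_pi_const] at h2
  exact h.trans h2

/-- The joint entropy of the first `k` sources and the encoder outputs in `U`. -/
noncomputable def jointEntropy (c : MultiCode L N S n M) (P : ∀ k, Measure (S k)) (k : ℕ)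
    (U : Finset (Fin L)) : ℝ :=
  entropy (c.law P) fun ω => (c.firstSources k ω, c.output U ω)

section

variable (c : MultiCode L N S n M) (P : ∀ k, Measure (S k)) [∀ k, IsProbabilityMeasure (P k)]

theorem jointEntropy_mono (k : ℕ) : Monotone (c.jointEntropy P k) := fun U V h =>
  entropy_le_of_determines ((c.measurable_firstSources k).prodMk (c.measurable_output V))
    fun ω ω' he => by
      rw [Prod.mk.injEq] at he ⊢
      exact ⟨he.1, c.output_eq_of_subset h he.2⟩

theorem jointEntropy_submodular (k : ℕ) (U V : Finset (Fin L)) :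
    c.jointEntropy P k (U ∪ V) + c.jointEntropy P k (U ∩ V)
      ≤ c.jointEntropy P k U + c.jointEntropy P k V := by
  have mU := c.measurable_output U
  have mV := c.measurable_output V
  have mW := (c.measurable_firstSources k).prodMk (c.measurable_output (U ∩ V))
  have h := entropy_submodular (μ := c.law P) mU mV mW
  refine le_trans (add_le_add ?_ le_rfl) (h.trans (add_le_add ?_ ?_))
  · refine entropy_le_of_determines (mU.prodMk (mV.prodMk mW)) fun ω ω' he => ?_
    simp only [Prod.mk.injEq] at he ⊢
    refine ⟨he.2.2.1, ?_⟩
    funext l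
    rcases Finset.mem_union.1 l.2 with hl | hl
    · exact congrFun he.1 ⟨l.1, hl⟩
    · exact congrFun he.2.1 ⟨l.1, hl⟩
  · refine entropy_le_of_determines ((c.measurable_firstSources k).prodMk mU) fun ω ω' he => ?_
    simp only [Prod.mk.injEq] at he ⊢
    exact ⟨he.2, he.1, c.output_eq_of_subset Finset.inter_subset_left he.2⟩
  · refine entropy_le_of_determines ((c.measurable_firstSources k).prodMk mV) fun ω ω' he => ?_
    simp only [Prod.mk.injEq] at he ⊢
    exact ⟨he.2, he.1, c.output_eq_of_subset Finset.inter_subset_right he.2⟩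

theorem jointEntropy_singleton_le (l : Fin L) : c.jointEntropy P 0 {l} ≤ Real.log (M l) := by
  have hm : Measurable fun ω : (∀ k, Fin n → S k) × c.Key => c.enc l ω.1 ω.2 :=
    measurable_from_prod_countable_right fun s => c.measurable_enc l s
  have h := entropy_le_log_card (μ := c.law P) hm
  rw [Fintype.card_fin] at h
  refine le_trans (entropy_le_of_determines hm fun ω ω' he => ?_) h
  -- For k = 0 the source component is indexed by an empty type, so the output alone determines the
  -- pair.
  refine Prod.ext (funext fun i => absurd i.2 (Nat.not_lt_zero _)) (funext fun l' => ?_)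
  obtain ⟨l', hl'⟩ := l'
  obtain rfl := Finset.mem_singleton.1 hl'
  exact he

/-- Conditioning on the next source, decoded with small error probability. -/
theorem jointEntropy_succ_le {R : Fin L → ℝ} {ε : ℝ} (hc : c.Meets P R ε) (hε : 0 ≤ ε) {k : ℕ}
    {U : Finset (Fin L)} (hU : U.card = N + k + 1) :
    c.jointEntropy P (k + 1) U ≤ c.jointEntropy P k U
      + (Real.log 2 + ε * (n * ∑ i, Real.log (Fintype.card (S i)))) := by
  have hU' : N + 1 ≤ U.card := by omega
  have hne : ∀ i, Nonempty (S i) := fun i => (P i).nonempty_of_neZero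
  have mV : Measurable fun (ω : (∀ k, Fin n → S k) × c.Key)
      (i : {i : Fin (L - N) // N + (i + 1) ≤ U.card}) => ω.1 i.1 :=
    measurable_pi_lambda _ fun i => (measurable_pi_apply i.1).comp measurable_fst
  have mY := (c.measurable_firstSources k).prodMk (c.measurable_output U)
  have h := entropy_prod_le_of_decoder (μ := c.law P) mV mY fun y => c.dec U hU' y.2
  have h1 : c.jointEntropy P (k + 1) U ≤ _ :=
    entropy_le_of_determines (mV.prodMk mY) fun ω ω' he => by
      simp only [Prod.mk.injEq] at he ⊢
      -- As |U| = N + k + 1, the decoded indices are exactly those below k + 1.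
      refine ⟨funext fun i => ?_, he.2.2⟩
      exact congrFun he.1 ⟨i.1, by have := i.2; omega⟩
  refine h1.trans (h.trans ?_)
  rw [add_assoc]
  refine add_le_add le_rfl (add_le_add le_rfl ?_)
  refine mul_le_mul (hc.reconstruct U hU') ?_ (Real.log_natCast_nonneg _) hε
  have hcard : ∀ i, (0 : ℝ) ≤ Real.log (Fintype.card (S i)) := fun i => Real.log_natCast_nonneg _
  rw [Fintype.card_pi, Nat.cast_prod, Real.log_prod]
  · simp only [Fintype.card_pi, Finset.prod_const, Finset.card_univ, Fintype.card_fin,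
      Nat.cast_pow, Real.log_pow]
    rw [← Finset.mul_sum]
    refine mul_le_mul_of_nonneg_left ?_ (Nat.cast_nonneg n)
    -- Enlarging the sum to all sources makes the error term independent of k and U.
    rw [← Finset.sum_subtype (Finset.univ.filter fun i : Fin (L - N) => N + (i + 1) ≤ U.card)
      (by simp) (fun i => Real.log (Fintype.card (S i)))]
    exact Finset.sum_le_sum_of_subset_of_nonneg (Finset.subset_univ _) fun i _ _ => hcard i
  · intro i _
    exact_mod_cast Fintype.card_ne_zero

/-- Secrecy: any `N` outputs carry no information about the sources. -/
theorem jointEntropy_add_le {R : Fin L → ℝ} {ε : ℝ} (hc : c.Meets P R ε) {k : ℕ}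
    (hk : k < L - N) {A : Finset (Fin L)} (hA : A.card = N) :
    c.jointEntropy P k A + n * entropy (P ⟨k, hk⟩) id ≤ c.jointEntropy P (k + 1) A := by
  have mA := c.measurable_output A
  have mW := fun k => c.measurable_firstSources k
  have upper : c.jointEntropy P k A
      ≤ entropy (c.law P) (c.firstSources k) + entropy (c.law P) (c.output A) := by
    have h := entropy_submodular (μ := c.law P) (mW k) mA (measurable_const (a := ()))
    have h1 : c.jointEntropy P k A ≤ _ :=
      entropy_le_of_determines ((mW k).prodMk (mA.prodMk (measurable_const (a := ()))))
        fun ω ω' he => by simp_all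
    have h2 := entropy_le_of_determines (μ := c.law P)
      (X := fun ω => (c.firstSources k ω, ())) (mW k) fun ω ω' he => by simp_all
    have h3 := entropy_le_of_determines (μ := c.law P)
      (X := fun ω => (c.output A ω, ())) mA fun ω ω' he => by simp_all
    have h4 := entropy_nonneg (μ := c.law P) fun _ => ()
    linarith
  have lower : entropy (c.law P) (c.firstSources (k + 1)) + entropy (c.law P) (c.output A)
      ≤ c.jointEntropy P (k + 1) A := by
    -- Secrecy is given for all sources jointly; submodularity with the prefix as third variable
    -- transfers independence to the first k + 1 of them.
    have h := entropy_submodular (μ := c.law P) measurable_fst mA (mW (k + 1))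
    have hs := condEntropy_add_entropy (μ := c.law P) measurable_fst mA
    rw [hc.secret A hA.le] at hs
    have h1 := entropy_le_of_determines (μ := c.law P) (X := fun ω => (ω.1, c.output A ω))
      (measurable_fst.prodMk (mA.prodMk (mW (k + 1)))) fun ω ω' he => by simp_all
    have h2 := entropy_le_of_determines (μ := c.law P)
      (X := fun ω => (ω.1, c.firstSources (k + 1) ω)) measurable_fst fun ω ω' he =>
        Prod.ext he (funext fun i => congrFun he i.1)
    have h3 := entropy_le_of_determines (μ := c.law P)
      (X := fun ω => (c.output A ω, c.firstSources (k + 1) ω)) ((mW (k + 1)).prodMk mA)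
        fun ω ω' he => by simp_all
    have h4 : entropy (c.law P) (fun ω => (c.firstSources (k + 1) ω, c.output A ω))
      = c.jointEntropy P (k + 1) A := rfl
    linarith
  have hstep : entropy (c.law P) (c.firstSources (k + 1))
      = entropy (c.law P) (c.firstSources k) + n * entropy (P ⟨k, hk⟩) id := by
    rw [entropy_firstSources, entropy_firstSources]
    have : (Finset.univ.filter fun i : Fin (L - N) => i.val < k + 1)
        = insert ⟨k, hk⟩ (Finset.univ.filter fun i : Fin (L - N) => i.val < k) := by
      ext i
      simp only [Finset.mem_filter, Finset.mem_univ, true_and, Finset.mem_insert, Fin.ext_iff]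
      omega
    rw [this, Finset.sum_insert (by simp), add_comm]
  linarith

/-- The finite block length converse. -/
theorem sum_entropy_le_sum_log {R : Fin L → ℝ} {ε : ℝ} (hNL : N ≤ L) (hc : c.Meets P R ε)
    (hε : 0 ≤ ε) :
    ∑ k : Fin (L - N), (L : ℝ) / ((k : ℝ) + 1) * (n * entropy (P k) id
        - (Real.log 2 + ε * (n * ∑ i, Real.log (Fintype.card (S i)))))
      ≤ ∑ l, Real.log (M l) := by
  rcases Nat.eq_zero_or_pos L with rfl | hL
  · simp
  have : NeZero L := ⟨hL.ne'⟩
  have h := sum_le_sum_singleton_of_submodular hNL (c.jointEntropy P) (c.jointEntropy_mono P)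
    (c.jointEntropy_submodular P) (entropy_nonneg _)
    (fun k => if hk : k < L - N then n * entropy (P ⟨k, hk⟩) id else 0)
    (Real.log 2 + ε * (n * ∑ i, Real.log (Fintype.card (S i))))
    (fun k _ U hU => c.jointEntropy_succ_le P hc hε hU)
    (fun k hk A hA => by rw [dif_pos hk]; exact c.jointEntropy_add_le P hc hk hA)
  rw [Finset.sum_range] at h
  simp only [Fin.is_lt, dif_pos] at h
  exact h.trans (Finset.sum_le_sum fun l _ => c.jointEntropy_singleton_le P l)

end

end MultiCode

/-- The converse: a lower bound on the sum rate of every admissible rate tuple. -/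
theorem sum_entropy_le_of_mem_admissibleRegion {L N : ℕ} (hNL : N ≤ L) {S : Fin (L - N) → Type*}
    [∀ k, Fintype (S k)] [∀ k, MeasurableSpace (S k)] [∀ k, MeasurableSingletonClass (S k)]
    (P : ∀ k, Measure (S k)) [∀ k, IsProbabilityMeasure (P k)] {R : Fin L → ℝ}
    (hR : R ∈ admissibleRegion L N P) :
    ∑ k : Fin (L - N), (L : ℝ) / ((k : ℝ) + 1) * entropy (P k) id ≤ ∑ l, R l := by
  set C : ℝ := ∑ i, Real.log (Fintype.card (S i))
  set D : ℝ := ∑ k : Fin (L - N), (L : ℝ) / ((k : ℝ) + 1)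
  have hC : 0 ≤ C := Finset.sum_nonneg fun i _ => Real.log_natCast_nonneg _
  have hD : 0 ≤ D := Finset.sum_nonneg fun i _ => by positivity
  have key : ∀ ε > 0, ∑ k : Fin (L - N), (L : ℝ) / ((k : ℝ) + 1) * entropy (P k) id
      ≤ ∑ l, R l + ε * (L + D * (1 + C)) := by
    intro ε hε
    -- A large block length absorbs the constant log 2 from Fano's inequality into εn.
    have h1 : ∀ᶠ n : ℕ in Filter.atTop, Real.log 2 ≤ ε * n := by
      have := (tendsto_natCast_atTop_atTop (R := ℝ)).const_mul_atTop hε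
      exact this.eventually_ge_atTop _
    obtain ⟨n, ⟨M, c, hc⟩, hn, hn0⟩ :=
      ((hR.2 ε hε).and (h1.and (Filter.eventually_gt_atTop 0))).exists
    have hn0' : (0 : ℝ) < n := by exact_mod_cast hn0
    have h2 := c.sum_entropy_le_sum_log P hNL hc hε.le
    have h3 : ∑ l, Real.log (M l) ≤ n * (∑ l, R l + ε * L) := by
      have : ∀ l, Real.log (M l) ≤ n * (R l + ε) := fun l => by
        have := hc.rate l
        rwa [one_div, inv_mul_le_iff₀ hn0'] at this
      refine (Finset.sum_le_sum fun l _ => this l).trans_eq ?_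
      rw [← Finset.mul_sum, Finset.sum_add_distrib]
      simp [mul_comm]
    have h4 : ∑ k : Fin (L - N), (L : ℝ) / ((k : ℝ) + 1) * (n * entropy (P k) id
        - (Real.log 2 + ε * (n * C)))
        = n * ∑ k : Fin (L - N), (L : ℝ) / ((k : ℝ) + 1) * entropy (P k) id
          - D * (Real.log 2 + ε * (n * C)) := by
      generalize Real.log 2 + ε * (n * C) = x
      have hDx : D * x = ∑ k : Fin (L - N), (L : ℝ) / ((k : ℝ) + 1) * x := Finset.sum_mul _ _ _
      rw [hDx, Finset.mul_sum, ← Finset.sum_sub_distrib]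
      refine Finset.sum_congr rfl fun k _ => by ring
    rw [h4] at h2
    have h5 : D * (Real.log 2 + ε * (n * C)) ≤ D * (ε * n + ε * (n * C)) :=
      mul_le_mul_of_nonneg_left (by linarith) hD
    refine le_of_mul_le_mul_left ?_ hn0'
    linarith
  have hlim : Filter.Tendsto (fun ε : ℝ => ∑ l, R l + ε * (L + D * (1 + C)))
      (nhdsWithin 0 (Set.Ioi 0)) (nhds (∑ l, R l + 0 * (L + D * (1 + C)))) :=
    (Continuous.tendsto (by fun_prop) 0).mono_left nhdsWithin_le_nhds
  rw [zero_mul, add_zero] at hlim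
  exact ge_of_tendsto hlim (Filter.eventually_of_mem self_mem_nhdsWithin fun ε hε => key ε hε)

end SecureDiversity

namespace SecureDiversity

/-! ### Ramp secret sharing over a prime field -/

section Ramp

variable {p : ℕ} [Fact p.Prime]

/-- The value at `x` of the polynomial whose low coefficients are the key `κ` and whose high
coefficients are the message `a`. -/
def rampEval {N m : ℕ} (a : Fin m → ZMod p) (κ : Fin N → ZMod p) (x : ZMod p) : ZMod p :=
  ∑ i : Fin N, x ^ (i : ℕ) * κ i + ∑ i : Fin m, x ^ (N + i : ℕ) * a i

theorem rampEval_eq {N m : ℕ} (a : Fin m → ZMod p) (κ : Fin N → ZMod p) (x : ZMod p) :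
    rampEval a κ x = ∑ i : Fin (N + m), x ^ (i : ℕ) * (Fin.append κ a i) := by
  simp [rampEval, Fin.sum_univ_add]

theorem natCast_val_injective {L : ℕ} (hp : L ≤ p) :
    Function.Injective fun l : Fin L => ((l : ℕ) : ZMod p) := by
  intro l l' h
  have h' : ((l : ℕ) : ZMod p) = ((l' : ℕ) : ZMod p) := h
  rw [ZMod.natCast_eq_natCast_iff] at h'
  exact Fin.ext (h'.eq_of_lt_of_lt (l.2.trans_le hp) (l'.2.trans_le hp))

/-- The difference of the two coefficient vectors is annihilated by a Vandermonde matrix at N + m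
distinct points. -/
theorem rampEval_injective {L N m : ℕ} (hp : L ≤ p) {U : Finset (Fin L)} (hU : N + m ≤ U.card)
    {a a' : Fin m → ZMod p} {κ κ' : Fin N → ZMod p}
    (h : ∀ l ∈ U, rampEval a κ ((l : ℕ) : ZMod p) = rampEval a' κ' ((l : ℕ) : ZMod p)) :
    a = a' := by
  have hv : (Fin.append κ a - Fin.append κ' a' : Fin (N + m) → ZMod p) = 0 := by
    refine Matrix.eq_zero_of_forall_index_sum_pow_mul_eq_zero
      (f := fun j : Fin (N + m) => (((U.orderEmbOfFin rfl (Fin.castLE hU j) : Fin L) : ℕ) : ZMod p))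
      ?_ ?_
    · exact (natCast_val_injective hp).comp
        ((U.orderEmbOfFin rfl).injective.comp (Fin.castLE_injective hU))
    · intro j
      have := h _ (Finset.orderEmbOfFin_mem U rfl (Fin.castLE hU j))
      rw [rampEval_eq, rampEval_eq, ← sub_eq_zero, ← Finset.sum_sub_distrib] at this
      simpa only [Pi.sub_apply, mul_sub] using this
  funext i
  have := congrFun hv (Fin.natAdd N i)
  simpa [sub_eq_zero] using this

/-- The key polynomial interpolates the values on A, having degree below |A| ≤ N. Keeping the key in
the low coefficients makes this work even at the evaluation point 0. -/
theorem exists_key_of_values {L N : ℕ} (hp : L ≤ p) {A : Finset (Fin L)} (hA : A.card ≤ N)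
    (v : Fin L → ZMod p) :
    ∃ κ : Fin N → ZMod p, ∀ l ∈ A, ∑ i : Fin N, ((l : ℕ) : ZMod p) ^ (i : ℕ) * κ i = v l := by
  have hinj : Set.InjOn (fun l : Fin L => ((l : ℕ) : ZMod p)) A :=
    (natCast_val_injective hp).injOn
  set f := Lagrange.interpolate A (fun l : Fin L => ((l : ℕ) : ZMod p)) v with hf
  refine ⟨fun i => f.coeff i, fun l hl => ?_⟩
  rw [← Lagrange.eval_interpolate_at_node v hinj hl, ← hf]
  have hdeg : f.degree < N :=
    (Lagrange.degree_interpolate_lt v hinj).trans_le (by exact_mod_cast hA)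
  rw [Finset.sum_congr rfl fun i _ => mul_comm _ _,
    Fin.sum_univ_eq_sum_range (fun i => f.coeff i * ((l : ℕ) : ZMod p) ^ i) N]
  by_cases h0 : f = 0
  · simp [h0]
  · exact (Polynomial.eval_eq_sum_range' ((Polynomial.natDegree_lt_iff_degree_lt h0).2 hdeg) _).symm

/-- Shares in `A` for the message `a` look like shares for `a'` with a shifted key. -/
theorem exists_key_shift {L N m : ℕ} (hp : L ≤ p) {A : Finset (Fin L)} (hA : A.card ≤ N)
    (a a' : Fin m → ZMod p) :
    ∃ δ : Fin N → ZMod p, ∀ κ, ∀ l ∈ A,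
      rampEval a κ ((l : ℕ) : ZMod p) = rampEval a' (κ + δ) ((l : ℕ) : ZMod p) := by
  obtain ⟨δ, hδ⟩ := exists_key_of_values hp hA fun l =>
    ∑ i : Fin m, ((l : ℕ) : ZMod p) ^ (N + i : ℕ) * a i
      - ∑ i : Fin m, ((l : ℕ) : ZMod p) ^ (N + i : ℕ) * a' i
  refine ⟨δ, fun κ l hl => ?_⟩
  simp only [rampEval, Pi.add_apply, mul_add, Finset.sum_add_distrib, hδ l hl]
  ring

end Ramp

theorem uniformOn_univ_real_preimage_equiv {K : Type*} [Fintype K] [MeasurableSpace K]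
    [MeasurableSingletonClass K] (e : Equiv.Perm K) (s : Set K) :
    (uniformOn (Set.univ : Set K)).real (e ⁻¹' s) = (uniformOn (Set.univ : Set K)).real s := by
  rw [measureReal_def, measureReal_def, uniformOn_univ, uniformOn_univ,
    Measure.count_apply (Set.toFinite _).measurableSet,
    Measure.count_apply (Set.toFinite _).measurableSet, Set.encard_preimage_of_bijective e.bijective]

-- Single-level codes from polynomial shares

namespace SingleCode

universe u

variable {L m : ℕ} {S : Type u} {n : ℕ} {M : Fin L → ℕ}

/-- For every fixed source sequence, the outputs in any set of at most `N` encoders have the same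
distribution. -/
def KeySecret (c : SingleCode L m S n M) (N : ℕ) : Prop :=
  ∀ A : Finset (Fin L), A.card ≤ N → ∀ s s' y,
    c.keyLaw.real ((fun κ => c.output A (s, κ)) ⁻¹' {y})
      = c.keyLaw.real ((fun κ => c.output A (s', κ)) ⁻¹' {y})

/-- A code that recovers every source sequence in a given set `T` and is perfectly secret. -/
theorem exists_rampCode [Nonempty S] [Fintype S] {N p : ℕ} [Fact p.Prime] (hp : L ≤ p)
    (T : Finset (Fin n → S)) (hT : T.card ≤ p ^ m) :
    ∃ c : SingleCode L (N + m) S n (fun _ => p), c.KeySecret N ∧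
      ∀ U hU ω, ω.1 ∈ T → c.dec U hU (c.output U ω) = ω.1 := by
  classical
  -- Sequences outside T all get the zero message: they may be decoded wrongly, but secrecy holds
  -- for every sequence.
  obtain ⟨f, hf⟩ : ∃ f : (Fin n → S) → Fin m → ZMod p, Set.InjOn f T := by
    obtain ⟨g⟩ := Function.Embedding.nonempty_of_card_le (α := T) (β := Fin m → ZMod p) (by
      simpa [ZMod.card] using hT)
    refine ⟨fun s => if h : s ∈ T then g ⟨s, h⟩ else 0, fun s hs s' hs' he => ?_⟩
    have hs1 : s ∈ T := hs
    have hs2 : s' ∈ T := hs'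
    simp only [hs1, hs2, dif_pos] at he
    exact congrArg Subtype.val (g.injective he)
  let share : Fin L → (Fin n → S) → (Fin N → ZMod p) → Fin p := fun l s κ =>
    ⟨(rampEval (f s) κ ((l : ℕ) : ZMod p)).val, ZMod.val_lt _⟩
  have hshare : ∀ l s s' κ κ', share l s κ = share l s' κ' ↔
      rampEval (f s) κ ((l : ℕ) : ZMod p) = rampEval (f s') κ' ((l : ℕ) : ZMod p) := by
    intro l s s' κ κ'
    simp only [share, Fin.mk.injEq]
    exact (ZMod.val_injective p).eq_iff
  let dec : (U : Finset (Fin L)) → N + m ≤ U.card → ((l : U) → Fin p) → (Fin n → S) := fun U _ y =>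
    if h : ∃ s ∈ T, ∃ κ, ∀ l : U, share l s κ = y l then h.choose else Classical.arbitrary _
  refine ⟨{ Key := Fin N → ZMod p
            instMeas := inferInstance
            keyLaw := uniformOn Set.univ
            instProb := inferInstance
            enc := share
            measurable_enc := fun _ _ => Measurable.of_discrete
            dec := dec }, ?_, ?_⟩
  · intro A hA s s' y
    obtain ⟨δ, hδ⟩ := exists_key_shift hp hA (f s) (f s')
    refine Eq.trans ?_ (uniformOn_univ_real_preimage_equiv (Equiv.addRight δ) _)
    congr 1
    ext κ
    have : (fun l : A => share l s κ) = fun l : A => share l s' (κ + δ) := by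
      funext l
      rw [hshare]
      exact hδ κ l l.2
    change (fun l : A => share l s κ) = y ↔ (fun l : A => share l s' (κ + δ)) = y
    rw [this]
  · rintro U hU ⟨s, κ⟩ hs
    have h : ∃ s' ∈ T, ∃ κ', ∀ l : U, share l s' κ' = share l s κ := ⟨s, hs, κ, fun _ => rfl⟩
    change dec U hU (fun l : U => share l s κ) = s
    simp only [dec]
    rw [dif_pos h]
    obtain ⟨h1, κ', h2⟩ := h.choose_spec
    exact hf h1 hs (rampEval_injective hp hU (κ := κ') (κ' := κ) fun l hl =>
      (hshare _ _ _ _ _).1 (h2 ⟨l, hl⟩))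

end SingleCode

/-! ### Typical sequences -/

/-- T consists of the sequences of probability at least exp(-n(H + δ)), so total mass 1 bounds its
size. Chebyshev's inequality for the sum of the -log P(s_i) bounds its complement. -/
theorem exists_typicalSet {S : Type*} [Fintype S] [MeasurableSpace S] [MeasurableSingletonClass S]
    (P : Measure S) [IsProbabilityMeasure P] {δ ε : ℝ} (hδ : 0 < δ) (hε : 0 < ε) :
    ∀ᶠ n : ℕ in Filter.atTop, ∃ T : Finset (Fin n → S),
      (T.card : ℝ) ≤ Real.exp (n * (entropy P id + δ)) ∧
      (Measure.pi fun _ : Fin n => P).real (T : Set (Fin n → S))ᶜ ≤ ε := by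
  classical
  set X : S → ℝ := fun s => -Real.log (P.real {s}) with hX
  have hX2 : MemLp X 2 P := MemLp.of_discrete
  have hEX : ∫ s, X s ∂P = entropy P id := by
    rw [integral_fintype Integrable.of_finite, entropy_eq_sum]
    simp [hX]
  set V := variance X P
  have hlarge : ∀ᶠ n : ℕ in Filter.atTop, V / (ε * δ ^ 2) ≤ (n : ℝ) :=
    tendsto_natCast_atTop_atTop.eventually_ge_atTop _
  filter_upwards [hlarge, Filter.eventually_gt_atTop 0] with n hn hn0
  have hn0' : (0 : ℝ) < n := by exact_mod_cast hn0
  set μ := Measure.pi fun _ : Fin n => P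
  set Y : (Fin n → S) → ℝ := ∑ i, fun s => X (s i) with hY
  have hY2 : MemLp Y 2 μ := MemLp.of_discrete
  have hYv : variance Y μ = n * V := by
    rw [hY, variance_sum_pi (X := fun _ => X) fun _ => hX2]
    simp [V]
  have hYE : ∫ s, Y s ∂μ = n * entropy P id := by
    have h1 : ∀ s, Y s = ∑ i, X (s i) := fun s => by simp [hY]
    simp_rw [h1]
    rw [integral_finsetSum _ fun _ _ => Integrable.of_finite]
    have h2 : ∀ i : Fin n, ∫ s, X (s i) ∂μ = entropy P id := fun i => by
      have hp := measurePreserving_eval (fun _ : Fin n => P) i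
      have h3 := integral_map hp.aemeasurable (f := X) .of_discrete
      rw [hp.map_eq, hEX] at h3
      exact h3.symm
    simp [h2]
  have hcheb := meas_ge_le_variance_div_sq hY2 (c := n * δ) (by positivity)
  rw [hYv, hYE] at hcheb
  set B : Set (Fin n → S) := {s | n * δ ≤ |Y s - n * entropy P id|}
  have hB : μ.real B ≤ ε := by
    refine (ENNReal.toReal_mono ENNReal.ofReal_ne_top hcheb).trans ?_
    rw [ENNReal.toReal_ofReal (div_nonneg (mul_nonneg hn0'.le (variance_nonneg _ _))
      (sq_nonneg _))]
    rw [div_le_iff₀ (by positivity)] at hn ⊢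
    nlinarith [mul_le_mul_of_nonneg_left hn hn0'.le]
  have hsing : ∀ s : Fin n → S, μ.real {s} = ∏ i, P.real {s i} := fun s => by
    rw [measureReal_def, Measure.pi_singleton, ENNReal.toReal_prod]
    rfl
  set t : ℝ := n * (entropy P id + δ)
  refine ⟨Finset.univ.filter fun s => Real.exp (-t) ≤ μ.real {s}, ?_, ?_⟩
  · set T := Finset.univ.filter fun s => Real.exp (-t) ≤ μ.real {s}
    have h1 : (T.card : ℝ) * Real.exp (-t) ≤ 1 := by
      rw [← nsmul_eq_mul]
      refine (Finset.card_nsmul_le_sum T (fun s => μ.real {s}) _ fun s hs =>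
        (Finset.mem_filter.1 hs).2).trans ?_
      rw [sum_measureReal_singleton]
      exact measureReal_le_one
    rwa [Real.exp_neg, ← div_eq_mul_inv, div_le_one (Real.exp_pos _)] at h1
  · refine le_trans ?_ hB
    -- Null sequences are discarded first, since `Real.log 0 = 0` breaks the identity Y = -log P on
    -- them.
    rw [← Finset.coe_compl, ← sum_measureReal_singleton, ← Finset.sum_filter_ne_zero,
      ← Set.coe_toFinset B, ← sum_measureReal_singleton]
    refine Finset.sum_le_sum_of_subset_of_nonneg (fun s hs => ?_) fun _ _ _ => measureReal_nonneg
    simp only [Finset.mem_filter, Finset.mem_compl, Finset.mem_univ, true_and, not_le] at hs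
    obtain ⟨hs1, hs2⟩ := hs
    rw [Set.mem_toFinset]
    have hne : ∀ i, P.real {s i} ≠ 0 := fun i h0 =>
      hs2 (by rw [hsing]; exact Finset.prod_eq_zero (Finset.mem_univ i) h0)
    have hlog : Real.log (μ.real {s}) = - Y s := by
      rw [hsing, Real.log_prod fun i _ => hne i]
      simp [hY, hX]
    have hlt : Real.log (μ.real {s}) < -t := by
      rw [← Real.log_exp (-t)]
      exact Real.log_lt_log (measureReal_nonneg.lt_of_ne (Ne.symm hs2)) hs1
    rw [hlog] at hlt
    change n * δ ≤ |Y s - n * entropy P id|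
    refine le_trans ?_ (le_abs_self _)
    have : t = n * entropy P id + n * δ := by simp only [t]; ring
    linarith

end SecureDiversity

namespace SecureDiversity

/-! ### Achievability -/

/-- Perfect secrecy in terms of entropy follows from equality of the conditional laws. -/
theorem condEntropy_fst_eq_entropy {α K β : Type*} [Fintype α] [MeasurableSpace α]
    [MeasurableSingletonClass α] [MeasurableSpace K] [Fintype β] [MeasurableSpace β]
    [MeasurableSingletonClass β] (P : Measure α) [IsProbabilityMeasure P] (ν : Measure K)
    [IsProbabilityMeasure ν] {Y : α × K → β} (hY : Measurable Y)
    (h : ∀ s s' y, ν.real ((fun κ => Y (s, κ)) ⁻¹' {y}) = ν.real ((fun κ => Y (s', κ)) ⁻¹' {y})) :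
    condEntropy (P.prod ν) Prod.fst Y = entropy (P.prod ν) Prod.fst := by
  set μ := P.prod ν
  obtain ⟨s₀⟩ : Nonempty α := P.nonempty_of_neZero
  set q : β → ℝ := fun y => ν.real ((fun κ => Y (s₀, κ)) ⁻¹' {y})
  have hjoint : ∀ x y, μ.real (Y ⁻¹' {y} ∩ Prod.fst ⁻¹' {x}) = P.real {x} * q y := by
    intro x y
    have hset : Y ⁻¹' {y} ∩ Prod.fst ⁻¹' {x} = {x} ×ˢ ((fun κ => Y (x, κ)) ⁻¹' {y}) := by
      ext ⟨a, κ⟩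
      simp only [Set.mem_inter_iff, Set.mem_preimage, Set.mem_singleton_iff, Set.mem_prod]
      constructor
      · rintro ⟨h1, rfl⟩; exact ⟨rfl, h1⟩
      · rintro ⟨rfl, h1⟩; exact ⟨h1, rfl⟩
    rw [hset, measureReal_prod_prod, h x s₀ y]
  have hP : ∑ x, P.real {x} = 1 := by
    simp
  have hfst : ∀ x, μ.real (Prod.fst ⁻¹' {x}) = P.real {x} := fun x =>
    measurePreserving_fst.measureReal_preimage (measurableSet_singleton x).nullMeasurableSet
  have hq : ∀ y, μ.real (Y ⁻¹' {y}) = q y := by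
    intro y
    rw [← sum_measureReal_prodMk_preimage (μ := μ) measurable_fst hY]
    have h3 : ∀ x, μ.real ((fun ω => (ω.1, Y ω)) ⁻¹' {(x, y)}) = P.real {x} * q y := by
      intro x
      rw [← hjoint]
      congr 1
      ext ω
      simp [and_comm]
    simp_rw [h3]
    rw [← Finset.sum_mul, hP, one_mul]
  have hterm : ∀ y, μ.real (Y ⁻¹' {y}) * entropy (cond μ (Y ⁻¹' {y})) Prod.fst
      = μ.real (Y ⁻¹' {y}) * entropy μ Prod.fst := by
    intro y
    by_cases h0 : q y = 0
    · rw [hq, h0, zero_mul, zero_mul]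
    · congr 1
      unfold entropy
      refine Finset.sum_congr rfl fun x _ => ?_
      rw [hfst, measureReal_def, cond_apply (hY (measurableSet_singleton y)), ENNReal.toReal_mul,
        ENNReal.toReal_inv, ← measureReal_def, ← measureReal_def, hjoint, hq]
      congr 1
      field_simp
  unfold condEntropy
  rw [Finset.sum_congr rfl fun y _ => hterm y, ← Finset.sum_mul,
    sum_measureReal_preimage_univ hY, one_mul]

namespace SingleCode

universe u

variable {L m : ℕ} {S : Type u} {n : ℕ} {M : Fin L → ℕ} [Fintype S] [MeasurableSpace S]

theorem Meets.mono {c : SingleCode L m S n M} {P : Measure S} {N : ℕ} {R : Fin L → ℝ}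
    {ε ε' : ℝ} (h : c.Meets P N R ε) (hε : ε ≤ ε') : c.Meets P N R ε' :=
  ⟨fun l => (h.rate l).trans (by linarith), fun U hU => (h.reconstruct U hU).trans hε, h.secret⟩

variable [MeasurableSingletonClass S]

theorem measurable_output (c : SingleCode L m S n M) (U : Finset (Fin L)) :
    Measurable (c.output U) :=
  measurable_pi_lambda _ fun l =>
    measurable_from_prod_countable_right fun s => c.measurable_enc l s

theorem exists_meets (P : Measure S) [IsProbabilityMeasure P] {N : ℕ} (hm : 0 < m) {ε : ℝ}
    (hε : 0 < ε) :
    ∀ᶠ n : ℕ in Filter.atTop, ∃ (M : Fin L → ℕ) (c : SingleCode L (N + m) S n M),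
      c.Meets P N (fun _ => entropy P id / m) ε ∧ c.KeySecret N := by
  have : Nonempty S := P.nonempty_of_neZero
  have hm' : (1 : ℝ) ≤ m := by exact_mod_cast hm
  have hlarge : ∀ᶠ n : ℕ in Filter.atTop, (Real.log 2 + Real.log (L + 2)) / (ε / 2) ≤ (n : ℝ) :=
    tendsto_natCast_atTop_atTop.eventually_ge_atTop _
  filter_upwards [hlarge, Filter.eventually_gt_atTop 0,
    exists_typicalSet P (half_pos hε) hε] with n hn hn0 ⟨T, hT, hTε⟩
  have hn0' : (0 : ℝ) < n := by exact_mod_cast hn0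
  set H := entropy P id
  have hH : 0 ≤ H := entropy_nonneg _
  set x : ℝ := n * (H + ε / 2) / m with hx
  have hx0 : 0 ≤ x := by positivity
  have hex : 1 ≤ Real.exp x := Real.one_le_exp hx0
  -- Bertrand's postulate. The summand L guarantees enough evaluation points; the factor 2 and L
  -- cost only log 2 + log(L + 2), absorbed into nε/2.
  obtain ⟨p, hp, hqp, hpq⟩ := Nat.exists_prime_lt_and_le_two_mul (⌈Real.exp x⌉₊ + L) (by
    have := Nat.ceil_pos.2 (Real.exp_pos x)
    omega)
  have : Fact p.Prime := ⟨hp⟩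
  have hpx : Real.exp x ≤ p :=
    (Nat.le_ceil _).trans (by exact_mod_cast (Nat.le_add_right _ L).trans hqp.le)
  have hcard : T.card ≤ p ^ m := by
    have h1 : Real.exp (n * (H + ε / 2)) = Real.exp x ^ m := by
      rw [← Real.exp_nat_mul, hx]
      congr 1
      field_simp
    rw [h1] at hT
    exact_mod_cast hT.trans (pow_le_pow_left₀ (Real.exp_pos x).le hpx m)
  obtain ⟨c, hsec, hdec⟩ := exists_rampCode (L := L) (m := m) (N := N) (p := p) (by omega) T hcard
  refine ⟨_, c, ⟨fun l => ?_, fun U hU => ?_, fun A hA => ?_⟩, hsec⟩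
  · have hple : (p : ℝ) ≤ 2 * ((L + 2) * Real.exp x) := by
      have h1 : (p : ℝ) ≤ 2 * ((⌈Real.exp x⌉₊ : ℝ) + L) := by exact_mod_cast hpq
      have h2 := (Nat.ceil_lt_add_one (Real.exp_pos x).le).le
      have h3 : (L : ℝ) ≤ L * Real.exp x := le_mul_of_one_le_right (Nat.cast_nonneg _) hex
      linarith
    have hp0 : (0 : ℝ) < p := by exact_mod_cast hp.pos
    have hlog : Real.log p ≤ Real.log 2 + Real.log (L + 2) + x := by
      refine (Real.log_le_log hp0 hple).trans_eq ?_
      rw [Real.log_mul two_ne_zero (by positivity), Real.log_mul (by positivity)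
        (Real.exp_pos x).ne', Real.log_exp, add_assoc]
    rw [one_div, inv_mul_le_iff₀ hn0']
    rw [div_le_iff₀ (half_pos hε)] at hn
    have hxle : x ≤ n * (H / m + ε / 2) := by
      have h1 : x = n * (H / m + ε / 2 / m) := by rw [hx]; ring
      rw [h1]
      have h2 := div_le_self (half_pos hε).le hm'
      exact mul_le_mul_of_nonneg_left (by linarith) hn0'.le
    linarith
  · refine le_trans ?_ hTε
    have hp : MeasurePreserving Prod.fst (c.law P) (Measure.pi fun _ : Fin n => P) :=
      measurePreserving_fst
    have hprob : IsProbabilityMeasure (c.law P) :=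
      inferInstanceAs (IsProbabilityMeasure ((Measure.pi fun _ => P).prod _))
    rw [← hp.measureReal_preimage (Set.toFinite _).measurableSet.nullMeasurableSet]
    refine measureReal_mono fun ω hω => ?_
    exact fun hT => hω (hdec U hU ω hT)
  · exact condEntropy_fst_eq_entropy _ _ (c.measurable_output A) (hsec A hA)

end SingleCode

-- Superposition of the component codes

section Superposition

universe u

variable {L N : ℕ} {S : Fin (L - N) → Type u} {n : ℕ} {M : Fin (L - N) → Fin L → ℕ}
  [∀ k, MeasurableSpace (S k)]

theorem measurePreserving_component
    (c : ∀ k : Fin (L - N), SingleCode L (N + (k + 1)) (S k) n (M k)) (P : ∀ k, Measure (S k))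
    [∀ k, IsProbabilityMeasure (P k)] (k : Fin (L - N)) :
    MeasurePreserving (fun ω : (∀ k, Fin n → S k) × (∀ k, (c k).Key) => (ω.1 k, ω.2 k))
      ((superposition c).law P) ((c k).law (P k)) :=
  (measurePreserving_eval (fun k => Measure.pi fun _ : Fin n => P k) k).prod
    (measurePreserving_eval (fun k => (c k).keyLaw) k)

variable [∀ k, Fintype (S k)]

theorem superpositionRegion_subset_admissibleRegion (P : ∀ k, Measure (S k)) :
    superpositionRegion L N P ⊆ admissibleRegion L N P := by
  rintro _ ⟨r, hr, rfl, h⟩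
  refine ⟨fun l => ?_, fun ε hε => (h ε hε).mono fun n ⟨M, c, _, hc⟩ => ⟨_, _, hc⟩⟩
  rw [Finset.sum_apply]
  exact Finset.sum_nonneg fun k _ => hr k l

variable [∀ k, MeasurableSingletonClass (S k)]

/-- Rate slacks add, errors obey a union bound over at most L - N components, and for fixed sources
the law of the outputs is a product over the independent keys, so `KeySecret` passes to the whole
code. -/
theorem superposition_meets
    {c : ∀ k : Fin (L - N), SingleCode L (N + (k + 1)) (S k) n (M k)} {P : ∀ k, Measure (S k)}
    [∀ k, IsProbabilityMeasure (P k)] {r : Fin (L - N) → Fin L → ℝ} {ε : ℝ} (hε : 0 ≤ ε)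
    (hc : ∀ k, (c k).Meets (P k) N (r k) ε) (hs : ∀ k, (c k).KeySecret N) :
    (superposition c).Meets P (∑ k, r k) ((L - N : ℕ) * ε) := by
  have hsne : Nonempty (∀ k, Fin n → S k) := ⟨fun k _ => (P k).nonempty_of_neZero.some⟩
  refine ⟨fun l => ?_, fun U hU => ?_, fun A hA => ?_⟩
  · have hM : ∀ k ∈ Finset.univ, (M k l : ℝ) ≠ 0 := by
      intro k _ h0
      have : M k l = 0 := by exact_mod_cast h0
      have κ := (c k).keyLaw.nonempty_of_neZero.some
      have := ((c k).enc l (hsne.some k) κ).2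
      omega
    rw [Nat.cast_prod, Real.log_prod hM, Finset.mul_sum, Finset.sum_apply]
    refine (Finset.sum_le_sum fun k _ => (hc k).rate l).trans_eq ?_
    simp [Finset.sum_add_distrib]
  · set err : {k : Fin (L - N) // N + (k + 1) ≤ U.card} →
        Set ((∀ k, Fin n → S k) × (superposition c).Key) := fun k =>
      (fun ω => (ω.1 k.1, ω.2 k.1)) ⁻¹'
        {ω | (c k.1).dec U k.2 ((c k.1).output U ω) ≠ ω.1}
    have hsub : {ω | (superposition c).dec U hU ((superposition c).output U ω)
        ≠ fun k => ω.1 (Subtype.val k)} ⊆ ⋃ k, err k := by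
      intro ω hω
      obtain ⟨k, hk⟩ := Function.ne_iff.1 hω
      refine Set.mem_iUnion.2 ⟨k, ?_⟩
      change (c k.1).dec U k.2 (fun l => (c k.1).enc l (ω.1 k.1) (ω.2 k.1)) ≠ ω.1 k.1
      convert hk using 1
      change _ = (c k.1).dec U k.2 fun l => finPiFinEquiv.symm
        (finPiFinEquiv fun k => (c k).enc l (ω.1 k) (ω.2 k)) k.1
      simp
    have herr : ∀ k, ((superposition c).law P).real (err k) ≤ ε := by
      intro k
      refine le_trans (le_of_eq ?_) ((hc k.1).reconstruct U k.2)
      refine (measurePreserving_component c P k.1).measureReal_preimage ?_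
      refine MeasurableSet.nullMeasurableSet ?_
      refine (measurableSet_eq_fun ?_ measurable_fst).compl
      exact Measurable.of_discrete.comp ((c k.1).measurable_output U)
    refine (measureReal_mono hsub).trans ((measureReal_iUnion_fintype_le err).trans ?_)
    refine (Finset.sum_le_sum fun k _ => herr k).trans ?_
    rw [Finset.sum_const, nsmul_eq_mul]
    refine mul_le_mul_of_nonneg_right ?_ hε
    rw [Finset.card_univ]
    exact_mod_cast (Fintype.card_subtype_le _).trans_eq (Fintype.card_fin _)
  · refine condEntropy_fst_eq_entropy _ _ ((superposition c).measurable_output A) ?_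
    intro s s' y
    have key : ∀ s : ∀ k, Fin n → S k,
        (superposition c).keyLaw.real ((fun κ => (superposition c).output A (s, κ)) ⁻¹' {y})
          = ∏ k, (c k).keyLaw.real ((fun κ => (c k).output A (s k, κ)) ⁻¹'
            {fun l => finPiFinEquiv.symm (y l) k}) := by
      intro s
      have hset : (fun κ => (superposition c).output A (s, κ)) ⁻¹' {y}
          = Set.univ.pi fun k => (fun κ => (c k).output A (s k, κ)) ⁻¹'
            {fun l => finPiFinEquiv.symm (y l) k} := by
        ext κ
        refine Iff.trans ?_ Set.mem_univ_pi.symm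
        change (fun l : A => finPiFinEquiv fun k => (c k).enc l (s k) (κ k)) = y ↔
          ∀ k, (fun l : A => (c k).enc l (s k) (κ k)) = _
        simp only [funext_iff, ← Equiv.eq_symm_apply]
        exact forall_comm
      rw [hset]
      change (Measure.pi fun k => (c k).keyLaw).real _ = _
      rw [measureReal_def, Measure.pi_pi, ENNReal.toReal_prod]
      rfl
    rw [key, key]
    exact Finset.prod_congr rfl fun k _ => hs k A hA _ _ _

/-- Superposition of ramp secret sharing codes. -/
theorem mem_superpositionRegion (P : ∀ k, Measure (S k)) [∀ k, IsProbabilityMeasure (P k)] :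
    (∑ k : Fin (L - N), fun _ : Fin L => entropy (P k) id / ((k : ℝ) + 1))
      ∈ superpositionRegion L N P := by
  refine ⟨_, fun k l => div_nonneg (entropy_nonneg _) (by positivity), rfl, fun ε hε => ?_⟩
  -- The L - N component slacks must add up to at most ε; the extra 1 keeps the denominator positive
  -- when L = N.
  set ε' : ℝ := ε / ((L - N : ℕ) + 1) with hε'
  have hpos : (0 : ℝ) < (L - N : ℕ) + 1 := by positivity
  have h0 : 0 < ε' := div_pos hε hpos
  have hle : ε' ≤ ε := div_le_self hε.le (by linarith [Nat.cast_nonneg (α := ℝ) (L - N)])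
  have hev : ∀ᶠ n : ℕ in Filter.atTop, ∀ k : Fin (L - N), ∃ (M : Fin L → ℕ)
      (c : SingleCode L (N + (k + 1)) (S k) n M),
      c.Meets (P k) N (fun _ => entropy (P k) id / ((k : ℝ) + 1)) ε' ∧ c.KeySecret N := by
    rw [Filter.eventually_all]
    intro k
    have := SingleCode.exists_meets (L := L) (P k) (N := N) (Nat.succ_pos k) h0
    push_cast at this
    exact this
  filter_upwards [hev] with n hn
  choose M c hc hs using hn
  refine ⟨M, c, fun k => (hc k).mono hle, ?_⟩
  have h := superposition_meets h0.le hc hs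
  have h1 : ((L - N : ℕ) : ℝ) * ε' ≤ ε := by
    rw [hε', ← mul_div_assoc, div_le_iff₀ hpos]
    linarith
  exact ⟨fun l => (h.rate l).trans (by linarith), fun U hU => (h.reconstruct U hU).trans h1,
    h.secret⟩

end Superposition

end SecureDiversity

theorem theorem2 (L N : ℕ) (hNL : N ≤ L) (S : Fin (L - N) → Type*)
    [∀ k, Fintype (S k)] [∀ k, MeasurableSpace (S k)] [∀ k, MeasurableSingletonClass (S k)]
    (P : ∀ k, Measure (S k)) [∀ k, IsProbabilityMeasure (P k)] :
    IsLeast ((fun R : Fin L → ℝ => ∑ l, R l) '' SecureDiversity.admissibleRegion L N P)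
      (∑ k : Fin (L - N), (L : ℝ) / ((k : ℝ) + 1) * SecureDiversity.entropy (P k) id) ∧
    ∃ R ∈ SecureDiversity.superpositionRegion L N P,
      ∑ l, R l = ∑ k : Fin (L - N), (L : ℝ) / ((k : ℝ) + 1) * SecureDiversity.entropy (P k) id := by
  have hmem := SecureDiversity.mem_superpositionRegion P
  have hsum : ∑ l, (∑ k : Fin (L - N),
      fun _ : Fin L => SecureDiversity.entropy (P k) id / ((k : ℝ) + 1)) l
      = ∑ k : Fin (L - N), (L : ℝ) / ((k : ℝ) + 1) * SecureDiversity.entropy (P k) id := by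
    simp only [Finset.sum_apply, Finset.sum_const, Finset.card_univ, Fintype.card_fin,
      nsmul_eq_mul, Finset.mul_sum]
    exact Finset.sum_congr rfl fun k _ => by ring
  refine ⟨⟨⟨_, SecureDiversity.superpositionRegion_subset_admissibleRegion P hmem, hsum⟩, ?_⟩,
    _, hmem, hsum⟩
  rintro _ ⟨R, hR, rfl⟩
  exact SecureDiversity.sum_entropy_le_of_mem_admissibleRegion hNL P hR
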